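/- Let $M$ be a nonzero integer. For a finite group $G$ write $\omega(G)=\{g^M : g\in G\}$ for the image of $G$ under the word $\omega = x^M$. For $n\ge 2$ and a prime power $q$ let $\mathrm{PSL}_n^+(q)=\mathrm{PSL}_n(q)$ be $\mathrm{SL}_n(q)$ modulo its centre, and let $\mathrm{PSL}_n^-(q)=\mathrm{PSU}_n(q)$ be $\mathrm{SU}_n(q)$ modulo its centre, where $\mathrm{SU}_n(q)$ is the group of $n\times n$ matrices $A$ over the field $\mathbb{F}_{q^2}$ with $\det A=1$ and $A\bar A^{T}=I$, $\bar A$ being obtained from $A$ by raising every entry to the power $q$. Then there is a positive constant $N$ depending only on $M$ such that, for all $n\ge 2$, all prime powers $q$ and both signs $\varepsilon\in\{+,-\}$, the group $G=\mathrm{PSL}_n^{\varepsilon}(q)$ satisfies $$|G|\ge N \implies |\omega(G)|\ \ge\ \frac{\ln n}{2n\cdot M^2}\,|G| .$$ -/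

import Mathlib

/-- The image `ω(G)` of the word map `G^d → G`, `(g₁, …, g_d) ↦ ω(g₁, …, g_d)`, attached to a word
`ω` in the free group on `d` generators: `FreeGroup.lift g` substitutes `g i` for the
`i`-th generator. -/
def wordImage {d : ℕ} (ω : FreeGroup (Fin d)) (G : Type*) [Group G] : Set G :=
  Set.range fun g : Fin d → G => FreeGroup.lift g ω

/-- The word `x ^ M` in one variable `x`. -/
def powerWord (M : ℤ) : FreeGroup (Fin 1) := FreeGroup.of 0 ^ M

/-- The image of the word `x ^ M` is the set of `M`-th powers. -/
theorem wordImage_powerWord (M : ℤ) (G : Type*) [Group G] :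
    wordImage (powerWord M) G = Set.range fun g : G => g ^ M := by
  ext y
  simp only [wordImage, powerWord, Set.mem_range, map_zpow, FreeGroup.lift_apply_of]
  exact ⟨fun ⟨g, hg⟩ => ⟨g 0, hg⟩, fun ⟨g, hg⟩ => ⟨fun _ => g, hg⟩⟩

/-- The special unitary group of the standard form `∑ i, x i * σ (y i)`: the matrices `A` with
`det A = 1` and `A * (σ A)ᵀ = 1`, where `σ` is applied entrywise. -/
def specialUnitarySubgroup (n : ℕ) {K : Type*} [CommRing K] (σ : K →+* K) :
    Subgroup (Matrix.SpecialLinearGroup (Fin n) K) where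
  carrier := {A | A.1 * (A.1.map σ).transpose = 1}
  one_mem' := by
    simp [Matrix.map_one]
  mul_mem' := by
    intro A B hA hB
    simp only [Set.mem_setOf_eq] at hA hB ⊢
    have h : (A * B).1 = A.1 * B.1 := rfl
    rw [h, Matrix.map_mul, Matrix.transpose_mul, Matrix.mul_assoc, ← Matrix.mul_assoc B.1, hB,
      Matrix.one_mul, hA]
  inv_mem' := by
    intro A hA
    simp only [Set.mem_setOf_eq] at hA ⊢
    have h1 : A.1 * (A⁻¹).1 = 1 := congrArg Subtype.val (mul_inv_cancel A)
    have h2 : (A⁻¹).1 * A.1 = 1 := congrArg Subtype.val (inv_mul_cancel A)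
    have h3 : ((A⁻¹).1.map σ).transpose * (A.1.map σ).transpose = 1 := by
      rw [← Matrix.transpose_mul, ← Matrix.map_mul, h1]
      simp [Matrix.map_one]
    have h4 : ((A⁻¹).1.map σ).transpose = A.1 := by
      calc ((A⁻¹).1.map σ).transpose
          = ((A⁻¹).1.map σ).transpose * ((A.1.map σ).transpose * A.1) := by
            rw [mul_eq_one_comm.mp hA, Matrix.mul_one]
        _ = A.1 := by rw [← Matrix.mul_assoc, h3, Matrix.one_mul]
    rw [h4, h2]

/-- The linear group `PSL_n(q)`, `q = p ^ k`: the group `SL_n(q)` over the field with `q` elements,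
modulo its centre. -/
abbrev PSLGroup (n p k : ℕ) [Fact p.Prime] : Type :=
  Matrix.ProjectiveSpecialLinearGroup (Fin n) (GaloisField p k)

/-- The unitary group `SU_n(q)`, `q = p ^ k`: the matrices `A` over the field with `q ^ 2` elements
such that `det A = 1` and `A * Āᵀ = 1`, where `Ā` is obtained from `A` by raising each
entry to the power `q`. -/
noncomputable abbrev SUGroup (n p k : ℕ) [Fact p.Prime] :
    Subgroup (Matrix.SpecialLinearGroup (Fin n) (GaloisField p (2 * k))) :=
  specialUnitarySubgroup n (iterateFrobenius (GaloisField p (2 * k)) p k)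

/-- The group `PSU_n(q)`, `q = p ^ k`: the group `SU_n(q)` modulo its centre. -/
abbrev PSUGroup (n p k : ℕ) [Fact p.Prime] : Type :=
  SUGroup n p k ⧸ Subgroup.center (SUGroup n p k)

/-!
The centre may be ignored, since passing to a quotient does not decrease the proportion of powers,
and only `m = |M|` matters. So let `G` be `SL_n(q)` or `SU_n(q)`, put `Q = q` or `Q = -q`
accordingly, and view `G` inside `SL_n(Ω)` for an algebraically closed field `Ω`.

Every permutation `π` of `n` points gives a finite torus in `G`: the diagonal matrices `d` of
determinant one with `d (π i) = d i ^ Q`, conjugated into `G` by one fixed matrix (`twistedTorus`,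
`ContainsTwistedTorus`). For `SL_n` the conjugating matrix is the Vandermonde matrix `V` of `n`
nodes that the `q`-Frobenius permutes as `π` permutes the indices. For `SU_n` it is `B * V`, where
`B` transforms the hermitian matrix `V * Vᵀ` to the identity; such a `B` exists because
nondegenerate hermitian forms over a finite field have orthonormal bases. An element of the torus
with distinct entries has the torus as its centralizer, and its entries are its eigenvalues, so that
they are determined by its conjugacy class.

If `π` has two cycles of lengths `a < b`, then an element of the torus `T` is given by an entry `x`
on the first cycle and an entry `y` on the second. Hence at most `m ^ 2` elements of `T` are killed
by `m`, so at least `|T| / m ^ 2` are `m`-th powers, and at most `a * b` elements with distinct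
entries are conjugate to a given one. Entries are repeated only if `x` or `y` has a short orbit
under the power map `x ↦ x ^ Q`, which is rare: the proportion of such elements is
`O(q ^ (-a / 2))`. Conjugating the `m`-th powers with distinct entries therefore yields
`(1 / m ^ 2 - O(q ^ (-a / 2))) / (a * b) * |G|` elements of `G` that are `m`-th powers
(`sum_mul_card_le_ncard_range_pow`), and the tori for different `a < n / 3` yield different
elements. Summation over `a < n / 3` gives `(log (n / 3) / m ^ 2 - O(1 / q)) / n`, which exceeds
`log n / (2 * n * m ^ 2)` if `n` is at least `21` and `n` or `q` is large. For smaller `n` the torus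
of an `n`-cycle is enough: its elements are determined by one entry, so it contributes
`(1 / m - O(n / q)) / n`, and `log n < 2 * m` in this range for `m ≥ 2`. For `m = 1` all elements
are powers. Finally, a lower bound for the order of the group forces `n` or `q` to be large.
-/

/-! ### Counting powers through conjugates of commutative subgroups -/

/-- The elements of a group that conjugate `a` to `x` form a coset of the centralizer of `a`, if
there are any. -/
theorem ncard_conj_eq_le_card_centralizer {G : Type*} [Group G] [Finite G] (a x : G) :
    {g : G | g * a * g⁻¹ = x}.ncard ≤ Nat.card (Subgroup.centralizer ({a} : Set G)) := by
  rcases Set.eq_empty_or_nonempty {g : G | g * a * g⁻¹ = x} with h | ⟨g₀, h₀⟩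
  · simp [h]
  · have h₀ : g₀ * a * g₀⁻¹ = x := h₀
    refine Set.ncard_le_ncard_of_injOn (t := (Subgroup.centralizer ({a} : Set G) : Set G))
      (fun g => g₀⁻¹ * g) ?_ ?_ (Set.toFinite _)
    · intro g hg
      have hg : g * a * g⁻¹ = x := hg
      have hg' : g * a = g₀ * a * g₀⁻¹ * g := by rw [h₀, ← hg]; group
      simp only [SetLike.mem_coe, Subgroup.mem_centralizer_singleton_iff]
      calc g₀⁻¹ * g * a = g₀⁻¹ * (g * a) := by group
        _ = a * (g₀⁻¹ * g) := by rw [hg']; group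
    · intro g _ g' _ h
      simpa using h

/-- Let `R` be a set of elements of a finite group `T`, mapped to `G` in such a way that images of
elements of `R` have centralizers no larger than `T` and that at most `w` elements of `R` have
images in a given conjugacy class. Then the conjugates of the images of a subset `B` of `R` make up
a proportion of at least `|B| / (w * |T|)` of `G`. -/
theorem card_mul_ncard_le_ncard_conjugates {G T : Type*} [Group G] [Finite G] [Group T] [Finite T]
    (τ : T →* G) (R B : Set T) (w : ℕ) (hBR : B ⊆ R)
    (hcent : ∀ r ∈ R, Nat.card (Subgroup.centralizer ({τ r} : Set G)) ≤ Nat.card T)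
    (hconj : ∀ r ∈ R, {r' ∈ R | IsConj (τ r) (τ r')}.ncard ≤ w) :
    Nat.card G * B.ncard ≤ w * Nat.card T * {x | ∃ t ∈ B, IsConj (τ t) x}.ncard := by
  classical
  have := Fintype.ofFinite G
  have := Fintype.ofFinite T
  rw [Set.ncard_eq_toFinset_card', Set.ncard_eq_toFinset_card' {x | ∃ t ∈ B, IsConj (τ t) x},
    Nat.card_eq_fintype_card, ← Finset.card_univ, ← Finset.card_product]
  refine Finset.card_le_mul_card_image_of_maps_to (f := fun y : G × T => y.1 * τ y.2 * y.1⁻¹)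
    ?_ _ ?_
  · rintro ⟨g, t⟩ h
    simp only [Finset.mem_product, Finset.mem_univ, true_and, Set.mem_toFinset] at h
    simp only [Set.mem_toFinset]
    exact ⟨t, h, isConj_iff.mpr ⟨g, rfl⟩⟩
  · intro x hx
    simp only [Set.mem_toFinset] at hx
    obtain ⟨t₀, ht₀, hx⟩ := hx
    have hw : {r' ∈ R | IsConj (τ t₀) (τ r')}.toFinset.card ≤ w := by
      rw [← Set.ncard_eq_toFinset_card']
      exact hconj t₀ (hBR ht₀)
    rw [mul_comm w]
    refine (Finset.card_le_mul_card_image_of_maps_to (f := Prod.snd)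
      (t := {r' ∈ R | IsConj (τ t₀) (τ r')}.toFinset) ?_ (Nat.card T) ?_).trans
      (Nat.mul_le_mul_left _ hw)
    · rintro ⟨g, t⟩ h
      simp only [Finset.mem_filter, Finset.mem_product, Finset.mem_univ, true_and,
        Set.mem_toFinset] at h
      simp only [Set.mem_toFinset]
      exact ⟨hBR h.1, hx.trans (isConj_iff.mpr ⟨g, h.2⟩).symm⟩
    · intro t ht
      simp only [Set.mem_toFinset] at ht
      -- the elements conjugating `τ t` to `x` are counted by its centralizer
      refine le_trans ?_ (hcent t ht.1)
      refine le_trans ?_ (ncard_conj_eq_le_card_centralizer (τ t) x)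
      rw [Set.ncard_eq_toFinset_card']
      refine Finset.card_le_card_of_injOn Prod.fst ?_ ?_
      · rintro ⟨g, t'⟩ h
        simp only [Finset.coe_filter, Finset.mem_filter, Finset.mem_product, Finset.mem_univ,
          true_and, Set.mem_toFinset] at h
        obtain ⟨⟨-, h⟩, rfl⟩ := h
        simpa using h
      · rintro ⟨g, t'⟩ h ⟨g', t''⟩ h' hgg
        simp only [Finset.coe_filter, Finset.mem_filter] at h h'
        obtain ⟨-, rfl⟩ := h
        obtain ⟨-, rfl⟩ := h'
        exact Prod.ext hgg rfl

/-- In a finite commutative group at most `c` of whose elements are killed by `m`, at least a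
proportion `1 / c` of the elements are `m`-th powers. -/
theorem card_le_mul_ncard_range_pow {T : Type*} [CommGroup T] [Finite T] (m c : ℕ)
    (hc : {t : T | t ^ m = 1}.ncard ≤ c) :
    Nat.card T ≤ c * (Set.range fun t : T => t ^ m).ncard := by
  have h := (powMonoidHom m : T →* T).ker.card_mul_index
  rw [Subgroup.index_ker] at h
  rw [← h]
  exact Nat.mul_le_mul_right _ hc

/-- The proportion of `m`-th powers in `G` is bounded below by a sum over commutative groups `T i`
mapped to `G`, each with a set `R i` of regular elements: `c i` bounds the `m`-torsion of `T i`,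
`δ i` the proportion of elements that are not regular, and `w i` the number of regular elements of
`T i` in a conjugacy class of `G`. -/
theorem sum_mul_card_le_ncard_range_pow {G J : Type*} [Group G] [Finite G] (I : Finset J)
    (T : J → Type*) [∀ i, CommGroup (T i)] [∀ i, Finite (T i)] (τ : ∀ i, T i →* G)
    (R : ∀ i, Set (T i)) (m : ℕ) (c w : J → ℕ) (δ : J → ℝ)
    (hcent : ∀ i ∈ I, ∀ r ∈ R i,
      Nat.card (Subgroup.centralizer ({τ i r} : Set G)) ≤ Nat.card (T i))
    (hconj : ∀ i ∈ I, ∀ r ∈ R i, {r' ∈ R i | IsConj (τ i r) (τ i r')}.ncard ≤ w i)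
    (hdisj : ∀ i ∈ I, ∀ j ∈ I, i ≠ j → ∀ r ∈ R i, ∀ r' ∈ R j, ¬ IsConj (τ i r) (τ j r'))
    (htors : ∀ i ∈ I, {t : T i | t ^ m = 1}.ncard ≤ c i)
    (hreg : ∀ i ∈ I, ((R i)ᶜ.ncard : ℝ) ≤ δ i * Nat.card (T i))
    (hc : ∀ i ∈ I, 0 < c i) (hw : ∀ i ∈ I, 0 < w i) :
    (∑ i ∈ I, (1 / c i - δ i) / w i) * (Nat.card G : ℝ) ≤
      ((Set.range fun g : G => g ^ m).ncard : ℝ) := by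
  classical
  set B : ∀ i, Set (T i) := fun i => R i ∩ Set.range fun t : T i => t ^ m with hB
  set X : J → Set G := fun i => {x | ∃ t ∈ B i, IsConj (τ i t) x} with hX
  have hXsub : (⋃ i ∈ I, X i) ⊆ Set.range fun g : G => g ^ m := by
    intro x hx
    simp only [Set.mem_iUnion] at hx
    obtain ⟨i, -, t, ⟨-, s, rfl⟩, hx⟩ := hx
    obtain ⟨g, rfl⟩ := isConj_iff.mp hx
    exact ⟨g * τ i s * g⁻¹, by simp [conj_pow]⟩
  have hXcard : ∑ i ∈ I, (X i).ncard = (⋃ i ∈ I, X i).ncard := by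
    have := Fintype.ofFinite G
    simp only [Set.ncard_eq_toFinset_card']
    rw [← Finset.card_biUnion]
    · congr 1
      ext x
      simp
    · intro i hi j hj hij
      rw [Function.onFun, Set.disjoint_toFinset, Set.disjoint_left]
      rintro x ⟨t, ht, hx⟩ ⟨t', ht', hx'⟩
      exact hdisj i hi j hj hij t ht.1 t' ht'.1 (hx.trans hx'.symm)
  have hle : ∀ i ∈ I, (1 / c i - δ i) / w i * (Nat.card G : ℝ) ≤ ((X i).ncard : ℝ) := by
    intro i hi
    have hT : (0 : ℝ) < Nat.card (T i) := by exact_mod_cast Nat.card_pos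
    have hc' : (0 : ℝ) < c i := by exact_mod_cast hc i hi
    have hw' : (0 : ℝ) < w i := by exact_mod_cast hw i hi
    have h1 : (Nat.card G : ℝ) * (B i).ncard ≤ w i * Nat.card (T i) * (X i).ncard := by
      exact_mod_cast card_mul_ncard_le_ncard_conjugates (τ i) (R i) (B i) (w i)
        Set.inter_subset_left (hcent i hi) (hconj i hi)
    have h2 : (Nat.card (T i) : ℝ) ≤ c i * (Set.range fun t : T i => t ^ m).ncard := by
      exact_mod_cast card_le_mul_ncard_range_pow m (c i) (htors i hi)
    have h3 : ((Set.range fun t : T i => t ^ m).ncard : ℝ) ≤ (B i).ncard + (R i)ᶜ.ncard := by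
      have : (Set.range fun t : T i => t ^ m) ⊆ B i ∪ (R i)ᶜ := by
        intro t ht
        by_cases h : t ∈ R i
        · exact Or.inl ⟨h, ht⟩
        · exact Or.inr h
      exact_mod_cast (Set.ncard_le_ncard this).trans (Set.ncard_union_le _ _)
    have h4 := hreg i hi
    have h5 : (1 / c i - δ i) * Nat.card (T i) ≤ ((B i).ncard : ℝ) := by
      have : (Nat.card (T i) : ℝ) / c i ≤ (Set.range fun t : T i => t ^ m).ncard := by
        rw [div_le_iff₀ hc']
        linarith
      have h6 : (1 / c i - δ i) * (Nat.card (T i) : ℝ) =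
        (Nat.card (T i) : ℝ) / c i - δ i * Nat.card (T i) := by ring
      linarith
    have hG : (0 : ℝ) ≤ Nat.card G := by positivity
    rw [div_mul_eq_mul_div, div_le_iff₀ hw']
    have h7 : (1 / c i - δ i) * (Nat.card G : ℝ) * Nat.card (T i) ≤
        (X i).ncard * w i * Nat.card (T i) := by
      calc (1 / c i - δ i) * (Nat.card G : ℝ) * Nat.card (T i)
          = Nat.card G * ((1 / c i - δ i) * Nat.card (T i)) := by ring
        _ ≤ Nat.card G * (B i).ncard := by gcongr
        _ ≤ _ := h1.trans_eq (by ring)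
    exact le_of_mul_le_mul_right h7 hT
  calc (∑ i ∈ I, (1 / c i - δ i) / w i) * (Nat.card G : ℝ)
      = ∑ i ∈ I, (1 / c i - δ i) / w i * (Nat.card G : ℝ) := Finset.sum_mul _ _ _
    _ ≤ ∑ i ∈ I, ((X i).ncard : ℝ) := Finset.sum_le_sum hle
    _ = ((⋃ i ∈ I, X i).ncard : ℝ) := by rw [← hXcard]; push_cast; rfl
    _ ≤ _ := by exact_mod_cast Set.ncard_le_ncard hXsub

/-- Passing to a quotient does not decrease the proportion of `m`-th powers. -/
theorem mul_card_quotient_le_ncard_range_pow {G : Type*} [Group G] [Finite G] (N : Subgroup G)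
    [N.Normal] (m : ℕ) (c : ℝ)
    (h : c * (Nat.card G : ℝ) ≤ ((Set.range fun g : G => g ^ m).ncard : ℝ)) :
    c * (Nat.card (G ⧸ N) : ℝ) ≤ ((Set.range fun g : G ⧸ N => g ^ m).ncard : ℝ) := by
  classical
  have := Fintype.ofFinite G
  have := Fintype.ofFinite (G ⧸ N)
  have hN : (0 : ℝ) < Nat.card N := by exact_mod_cast Nat.card_pos
  have h1 : (Set.range fun g : G => g ^ m).ncard ≤
      Nat.card N * (Set.range fun g : G ⧸ N => g ^ m).ncard := by
    rw [Set.ncard_eq_toFinset_card', Set.ncard_eq_toFinset_card']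
    refine Finset.card_le_mul_card_image_of_maps_to (f := QuotientGroup.mk' N) ?_ _ ?_
    · intro x hx
      simp only [Set.mem_toFinset] at hx ⊢
      obtain ⟨g, rfl⟩ := hx
      exact ⟨QuotientGroup.mk' N g, by simp⟩
    · intro x _
      obtain ⟨g₀, rfl⟩ := QuotientGroup.mk'_surjective N x
      rw [Nat.card_eq_fintype_card, ← Finset.card_univ]
      refine Finset.card_le_card_of_surjOn (fun y : N => g₀ * y) ?_
      intro g hg
      simp only [Finset.coe_filter, Set.mem_toFinset, Set.mem_ofPred_eq] at hg
      have : g₀⁻¹ * g ∈ N := by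
        rw [← QuotientGroup.eq]
        exact hg.2.symm
      exact ⟨⟨_, this⟩, by simp, by simp⟩
  have h1' : ((Set.range fun g : G => g ^ m).ncard : ℝ) ≤
      Nat.card N * (Set.range fun g : G ⧸ N => g ^ m).ncard := by exact_mod_cast h1
  have h2 : (Nat.card G : ℝ) = Nat.card (G ⧸ N) * Nat.card N := by
    exact_mod_cast Subgroup.card_eq_card_quotient_mul_card_subgroup N
  have h3 : c * (Nat.card (G ⧸ N) : ℝ) * Nat.card N ≤
      ((Set.range fun g : G ⧸ N => g ^ m).ncard : ℝ) * Nat.card N := by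
    rw [h2] at h
    linarith
  exact le_of_mul_le_mul_right h3 hN

/-- In a group, the `M`-th powers and the `|M|`-th powers are the same elements. -/
theorem range_zpow_eq_range_pow_natAbs (G : Type*) [Group G] (M : ℤ) :
    (Set.range fun g : G => g ^ M) = Set.range fun g : G => g ^ M.natAbs := by
  obtain ⟨m, rfl | rfl⟩ := M.eq_nat_or_neg
  · simp
  · ext x
    simp only [Set.mem_range, Int.natAbs_neg, Int.natAbs_natCast, zpow_neg, zpow_natCast]
    constructor
    · rintro ⟨g, rfl⟩
      exact ⟨g⁻¹, by simp⟩
    · rintro ⟨g, rfl⟩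
      exact ⟨g⁻¹, by simp⟩

/-! ### Twisted tori -/

/-- The torus attached to a permutation `π` of the index set and an integer `Q`: the diagonal
matrices of determinant one, given by their diagonals `d`, whose entries satisfy
`d (π i) = d i ^ Q`. For `Q = q` it is isomorphic to a maximal torus of the finite group `SL_n(q)`,
for `Q = -q` to one of `SU_n(q)`. -/
def twistedTorus {ι : Type*} [Fintype ι] (Ω : Type*) [Field Ω] (π : Equiv.Perm ι) (Q : ℤ) :
    Subgroup (ι → Ωˣ) where
  carrier := {d | (∀ i, d (π i) = d i ^ Q) ∧ ∏ i, d i = 1}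
  one_mem' := by simp
  mul_mem' := by
    rintro a b ⟨ha, ha'⟩ ⟨hb, hb'⟩
    exact ⟨fun i => by simp [ha, hb, mul_zpow], by simp [Finset.prod_mul_distrib, ha', hb']⟩
  inv_mem' := by
    rintro a ⟨ha, ha'⟩
    exact ⟨fun i => by simp [ha], by simp [ha']⟩

/-- The group `G`, mapped to `SL_n(Ω)` by `j`, contains the twisted torus of `π` and `Q` in the
strong sense that for some invertible `Z` (with inverse `Y`, and columns indexed by the set on
which `π` acts) a diagonal matrix `d` conjugates into the image of `G` exactly when `d` lies in the
torus. -/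
def ContainsTwistedTorus {G ι Ω : Type*} [Group G] [Field Ω] [Fintype ι] [DecidableEq ι] {n : ℕ}
    (j : G →* Matrix.SpecialLinearGroup (Fin n) Ω) (π : Equiv.Perm ι) (Q : ℤ) : Prop :=
  ∃ (Z : Matrix (Fin n) ι Ω) (Y : Matrix ι (Fin n) Ω), Z * Y = 1 ∧ Y * Z = 1 ∧
    ∀ d : ι → Ωˣ, (∃ g, (j g).1 = Z * Matrix.diagonal (fun i => (d i : Ω)) * Y) ↔
      d ∈ twistedTorus Ω π Q

/-- The eigenvalues of `Z * diagonal d * Z⁻¹` are the entries of `d`. -/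
theorem det_scalar_sub_conj_diagonal_eq_zero_iff {Ω ι : Type*} [Field Ω] [Fintype ι]
    [DecidableEq ι] {n : ℕ} {Z : Matrix (Fin n) ι Ω} {Y : Matrix ι (Fin n) Ω} (hZY : Z * Y = 1)
    (hYZ : Y * Z = 1) (d : ι → Ωˣ) (x : Ωˣ) :
    (Matrix.scalar (Fin n) (x : Ω) - Z * Matrix.diagonal (fun i => (d i : Ω)) * Y).det = 0 ↔
      x ∈ Set.range d := by
  have h : Matrix.scalar (Fin n) (x : Ω) - Z * Matrix.diagonal (fun i => (d i : Ω)) * Y =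
      Z * Matrix.diagonal (fun i => (x : Ω) - d i) * Y := by
    have h1 : Matrix.diagonal (fun i => (x : Ω) - d i) =
        (x : Ω) • (1 : Matrix ι ι Ω) - Matrix.diagonal (fun i => (d i : Ω)) := by
      ext i k
      rcases eq_or_ne i k with rfl | hik
      · simp
      · simp [hik]
    rw [h1, Matrix.mul_sub, Matrix.sub_mul, Matrix.mul_smul, Matrix.mul_one, Matrix.smul_mul, hZY,
      Matrix.scalar_apply, Matrix.smul_one_eq_diagonal]
  rw [h, Matrix.det_conj_of_mul_eq_one hZY hYZ, Matrix.det_diagonal, Finset.prod_eq_zero_iff]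
  simp [sub_eq_zero, Units.ext_iff, eq_comm]

/-- The eigenvalues of a matrix are invariant under conjugation. -/
theorem det_scalar_sub_eq_of_isConj {G Ω : Type*} [Group G] [Field Ω] {n : ℕ}
    (j : G →* Matrix.SpecialLinearGroup (Fin n) Ω) {a b : G} (h : IsConj a b) (x : Ω) :
    (Matrix.scalar (Fin n) x - (j a).1).det = (Matrix.scalar (Fin n) x - (j b).1).det := by
  obtain ⟨c, rfl⟩ := isConj_iff.mp h
  have h1 : (j c).1 * (j c⁻¹).1 = 1 := by
    rw [← Matrix.SpecialLinearGroup.coe_mul, ← map_mul]; simp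
  have h2 : (j c⁻¹).1 * (j c).1 = 1 := by
    rw [← Matrix.SpecialLinearGroup.coe_mul, ← map_mul]; simp
  have h3 : Matrix.scalar (Fin n) x - (j (c * a * c⁻¹)).1 =
      (j c).1 * (Matrix.scalar (Fin n) x - (j a).1) * (j c⁻¹).1 := by
    rw [Matrix.mul_sub, Matrix.sub_mul, map_mul, map_mul, Matrix.SpecialLinearGroup.coe_mul,
      Matrix.SpecialLinearGroup.coe_mul,
      ← (Matrix.scalar_commute x (fun r => mul_comm x r) (j c).1).eq,
      Matrix.mul_assoc (Matrix.scalar (Fin n) x), h1, Matrix.mul_one]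
  rw [h3, Matrix.det_conj_of_mul_eq_one h1 h2]

/-- A matrix commuting with a diagonal matrix with distinct entries is diagonal. -/
theorem eq_diagonal_of_commute_diagonal {Ω ι : Type*} [Field Ω] [Fintype ι] [DecidableEq ι]
    {d : ι → Ω} (hd : Function.Injective d) {X : Matrix ι ι Ω}
    (h : X * Matrix.diagonal d = Matrix.diagonal d * X) :
    X = Matrix.diagonal fun i => X i i := by
  ext i k
  rcases eq_or_ne i k with rfl | hik
  · simp
  · have h1 := congrFun (congrFun h i) k
    rw [Matrix.mul_diagonal, Matrix.diagonal_mul] at h1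
    have h2 : (d i - d k) * X i k = 0 := by rw [sub_mul, ← h1]; ring
    rw [Matrix.diagonal_apply_ne _ hik]
    exact (mul_eq_zero.mp h2).resolve_left (sub_ne_zero.mpr fun h => hik (hd h))

/-- A group containing a twisted torus receives an injective homomorphism from it. Elements of the
torus with distinct entries have centralizers no larger than the torus, and the eigenvalues of the
image of an element are its entries. -/
theorem ContainsTwistedTorus.exists_hom {G ι Ω : Type*} [Group G] [Finite G] [Field Ω] [Fintype ι]
    [DecidableEq ι] {n : ℕ} {j : G →* Matrix.SpecialLinearGroup (Fin n) Ω}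
    (hj : Function.Injective j) {π : Equiv.Perm ι} {Q : ℤ} (h : ContainsTwistedTorus j π Q) :
    Finite (twistedTorus Ω π Q) ∧ ∃ τ : twistedTorus Ω π Q →* G,
      (∀ r : twistedTorus Ω π Q, Function.Injective r.1 →
        Nat.card (Subgroup.centralizer ({τ r} : Set G)) ≤ Nat.card (twistedTorus Ω π Q)) ∧
      ∀ (t : twistedTorus Ω π Q) (x : Ωˣ),
        (Matrix.scalar (Fin n) (x : Ω) - (j (τ t)).1).det = 0 ↔ x ∈ Set.range t.1 := by
  obtain ⟨Z, Y, hZY, hYZ, h⟩ := h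
  choose τ hτ using fun t : twistedTorus Ω π Q => (h t.1).mpr t.2
  have hinj : Function.Injective τ := by
    intro t t' htt
    have h1 : Z * Matrix.diagonal (fun i => (t.1 i : Ω)) * Y =
        Z * Matrix.diagonal (fun i => (t'.1 i : Ω)) * Y := by rw [← hτ, ← hτ, htt]
    have h2 : Y * (Z * Matrix.diagonal (fun i => (t.1 i : Ω)) * Y) * Z =
        Y * (Z * Matrix.diagonal (fun i => (t'.1 i : Ω)) * Y) * Z := by rw [h1]
    have h3 : ∀ D : Matrix ι ι Ω, Y * (Z * D * Y) * Z = D := fun D => by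
      rw [← Matrix.mul_assoc, ← Matrix.mul_assoc, hYZ, Matrix.one_mul, Matrix.mul_assoc, hYZ,
        Matrix.mul_one]
    rw [h3, h3, Matrix.diagonal_eq_diagonal_iff] at h2
    ext i
    exact h2 i
  have hmul : ∀ t t', τ (t * t') = τ t * τ t' := by
    intro t t'
    apply hj
    apply Subtype.ext
    rw [map_mul, Matrix.SpecialLinearGroup.coe_mul, hτ, hτ, hτ]
    have : Z * Matrix.diagonal (fun i => (t.1 i : Ω)) * Y *
        (Z * Matrix.diagonal (fun i => (t'.1 i : Ω)) * Y) =
        Z * (Matrix.diagonal (fun i => (t.1 i : Ω)) * (Y * Z) *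
          Matrix.diagonal (fun i => (t'.1 i : Ω))) * Y := by
      simp only [Matrix.mul_assoc]
    rw [this, hYZ, Matrix.mul_one, Matrix.diagonal_mul_diagonal]
    simp
  have hfin : Finite (twistedTorus Ω π Q) := Finite.of_injective τ hinj
  refine ⟨hfin, MonoidHom.mk' τ hmul, ?_, ?_⟩
  · intro r hr
    have key : ∀ c : Subgroup.centralizer ({τ r} : Set G), ∃ t : twistedTorus Ω π Q,
        τ t = c.1 := by
      intro c
      have hc : c.1 * τ r = τ r * c.1 := Subgroup.mem_centralizer_singleton_iff.mp c.2
      have hc' : (j c.1).1 * (j (τ r)).1 = (j (τ r)).1 * (j c.1).1 := by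
        rw [← Matrix.SpecialLinearGroup.coe_mul, ← Matrix.SpecialLinearGroup.coe_mul, ← map_mul,
          ← map_mul, hc]
      set X := Y * (j c.1).1 * Z with hX
      have hcX : (j c.1).1 = Z * X * Y := by
        rw [hX, Matrix.mul_assoc, Matrix.mul_assoc (Y * _), hZY, Matrix.mul_one,
          ← Matrix.mul_assoc, hZY, Matrix.one_mul]
      have hcomm : X * Matrix.diagonal (fun i => (r.1 i : Ω)) =
          Matrix.diagonal (fun i => (r.1 i : Ω)) * X := by
        have h1 : Matrix.diagonal (fun i => (r.1 i : Ω)) = Y * (j (τ r)).1 * Z := by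
          rw [hτ, ← Matrix.mul_assoc, ← Matrix.mul_assoc, hYZ, Matrix.one_mul, Matrix.mul_assoc,
            hYZ, Matrix.mul_one]
        have h2 : ∀ A B : Matrix (Fin n) (Fin n) Ω, Y * A * Z * (Y * B * Z) = Y * (A * B) * Z := by
          intro A B
          calc Y * A * Z * (Y * B * Z) = Y * A * (Z * Y) * B * Z := by
                simp only [Matrix.mul_assoc]
            _ = _ := by rw [hZY, Matrix.mul_one, Matrix.mul_assoc Y A B]
        rw [h1, hX, h2, h2, hc']
      have hdiag := eq_diagonal_of_commute_diagonal
        (d := fun i => (r.1 i : Ω)) (fun a b hab => hr (Units.ext hab)) hcomm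
      have hdet : ∏ i, X i i = 1 := by
        rw [← Matrix.det_diagonal, ← hdiag, ← Matrix.det_conj_of_mul_eq_one hZY hYZ, ← hcX]
        exact (j c.1).2
      have hne : ∀ i, X i i ≠ 0 := fun i hi =>
        zero_ne_one
          ((Finset.prod_eq_zero (f := fun i => X i i) (Finset.mem_univ i) hi).symm.trans hdet)
      have hmem : (fun i => Units.mk0 (X i i) (hne i)) ∈ twistedTorus Ω π Q := by
        rw [← h]
        exact ⟨c.1, by simpa [← hdiag] using hcX⟩
      refine ⟨⟨_, hmem⟩, hj (Subtype.ext ?_)⟩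
      rw [hτ]
      simpa [← hdiag] using hcX.symm
    choose f hf using key
    refine Nat.card_le_card_of_injective f fun c c' hcc => ?_
    apply Subtype.ext
    rw [← hf c, ← hf c', hcc]
  · intro t x
    have : (j (MonoidHom.mk' τ hmul t)).1 = Z * Matrix.diagonal (fun i => (t.1 i : Ω)) * Y := hτ t
    rw [this]
    exact det_scalar_sub_conj_diagonal_eq_zero_iff hZY hYZ t.1 x

/-! ### Hermitian forms over a quadratic extension -/

/-- Let `σ` be an involution of a field `K` all of whose fixed elements are norms `x * σ x`. Then
every nondegenerate `σ`-hermitian matrix is congruent to the identity matrix. An orthonormal family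
with fewer than `n` members can be enlarged: its orthogonal complement `W` is nonzero, and the form
does not vanish on `W`; by polarization there is a vector `w ∈ W` with `h w w ≠ 0`, and it can be
scaled to length one. -/
theorem exists_mul_mul_map_transpose_eq_one {K : Type*} [Field K] (σ : K →+* K)
    (hσσ : ∀ x, σ (σ x) = x) (hne : ∃ x, x + σ x ≠ 0) (hnorm : ∀ c, σ c = c → ∃ x, x * σ x = c)
    {n : ℕ} (H : Matrix (Fin n) (Fin n) K) (hH : (H.map σ).transpose = H) (hdet : IsUnit H.det) :
    ∃ B : Matrix (Fin n) (Fin n) K, B * H * (B.map σ).transpose = 1 := by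
  set h : (Fin n → K) → (Fin n → K) → K := fun x y => x ⬝ᵥ H.mulVec (fun i => σ (y i)) with hh
  have h_add : ∀ x x' y, h (x + x') y = h x y + h x' y := fun x x' y => add_dotProduct _ _ _
  have h_smul : ∀ (c : K) x y, h (c • x) y = c * h x y := fun c x y => smul_dotProduct _ _ _
  have h_symm : ∀ x y, σ (h x y) = h y x := by
    intro x y
    have hH' : ∀ i k, σ (H i k) = H k i := fun i k => by
      conv_rhs => rw [← hH]
      rfl
    simp only [hh, dotProduct, Matrix.mulVec, map_sum, map_mul, hσσ, hH', Finset.mul_sum]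
    rw [Finset.sum_comm]
    refine Finset.sum_congr rfl fun i _ => Finset.sum_congr rfl fun k _ => by ring
  have h_add' : ∀ x y y', h x (y + y') = h x y + h x y' := fun x y y' => by
    rw [← h_symm, h_add, map_add, h_symm, h_symm]
  have h_smul' : ∀ (c : K) x y, h x (c • y) = σ c * h x y := fun c x y => by
    rw [← h_symm, h_smul, map_mul, h_symm]
  have h_sum' : ∀ {m : ℕ} x (f : Fin m → Fin n → K), h x (∑ i, f i) = ∑ i, h x (f i) :=
    fun x f => map_sum (AddMonoidHom.mk' (h x) (h_add' x)) f Finset.univ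
  have h_sum : ∀ {m : ℕ} y (f : Fin m → Fin n → K), h (∑ i, f i) y = ∑ i, h (f i) y :=
    fun y f => map_sum (AddMonoidHom.mk' (fun x => h x y) (fun a b => h_add a b y)) f Finset.univ
  have main : ∀ m ≤ n, ∃ v : Fin m → Fin n → K, ∀ i k, h (v i) (v k) = if i = k then 1 else 0 := by
    intro m
    induction m with
    | zero => exact fun _ => ⟨fun i => i.elim0, fun i => i.elim0⟩
    | succ m ih =>
      intro hm
      obtain ⟨v, hv⟩ := ih (by omega)
      let L : (Fin n → K) →ₗ[K] (Fin m → K) :=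
        { toFun := fun x i => h x (v i)
          map_add' := fun x y => funext fun i => h_add x y (v i)
          map_smul' := fun c x => funext fun i => h_smul c x (v i) }
      have hker : LinearMap.ker L ≠ ⊥ := LinearMap.ker_ne_bot_of_finrank_lt (by simpa using hm)
      obtain ⟨x, hx, hx0⟩ := (Submodule.ne_bot_iff _).mp hker
      have hxv : ∀ i, h x (v i) = 0 := fun i => congrFun (LinearMap.mem_ker.mp hx) i
      -- a vector `y` orthogonal to the family with `h x y ≠ 0`
      have hy : ∃ y, (∀ i, h y (v i) = 0) ∧ h x y ≠ 0 := by
        by_contra! hcon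
        have hzero : ∀ y, h x y = 0 := by
          intro y
          have h1 := hcon (y - ∑ i, h y (v i) • v i) (by
            intro k
            rw [sub_eq_add_neg, ← neg_one_smul K, h_add, h_smul, h_sum]
            simp [h_smul, hv])
          rw [sub_eq_add_neg, ← neg_one_smul K, h_add', h_smul', h_sum'] at h1
          simpa [h_smul', hxv] using h1
        apply hx0
        have h2 : Matrix.vecMul x H = 0 := by
          ext i
          have h3 := hzero (Pi.single i 1)
          simp only [hh] at h3
          rw [Matrix.dotProduct_mulVec] at h3
          have h4 : (fun k => σ ((Pi.single i 1 : Fin n → K) k)) = Pi.single i 1 := by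
            ext k
            rcases eq_or_ne k i with rfl | hk
            · simp
            · simp [hk]
          rw [h4] at h3
          simpa using h3
        have h5 : Matrix.vecMul (Matrix.vecMul x H) H⁻¹ = 0 := by rw [h2, Matrix.zero_vecMul]
        rwa [Matrix.vecMul_vecMul, Matrix.mul_nonsing_inv _ hdet, Matrix.vecMul_one] at h5
      obtain ⟨y, hyv, hxy⟩ := hy
      -- polarization: otherwise `t + σ t = 0` for all multiples `t` of `h x y`
      have hw : ∃ w, (∀ i, h w (v i) = 0) ∧ h w w ≠ 0 := by
        by_contra! hcon
        obtain ⟨u, hu⟩ := hne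
        apply hu
        have h1 : ∀ c : K, h (c • x) (c • x) = 0 := fun c =>
          hcon _ fun i => by rw [h_smul, hxv, mul_zero]
        have h2 := hcon ((u / h x y) • x + y) fun i => by
          rw [h_add, h_smul, hxv, hyv, mul_zero, add_zero]
        rw [h_add, h_add', h_add', h1, hcon y hyv, ← h_symm (_ • x) y, h_smul,
          div_mul_cancel₀ _ hxy] at h2
        simpa using h2
      obtain ⟨w, hwv, hww⟩ := hw
      obtain ⟨c, hc⟩ := hnorm (h w w) (h_symm w w)
      have hc0 : c ≠ 0 := by
        rintro rfl
        exact hww (by rw [← hc, zero_mul])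
      have hvw : ∀ i, h (v i) w = 0 := fun i => by rw [← h_symm, hwv, map_zero]
      refine ⟨Fin.cons (c⁻¹ • w) v, fun i k => ?_⟩
      refine Fin.cases ?_ (fun i => ?_) i <;> refine Fin.cases ?_ (fun k => ?_) k
      · have hc1 : σ c ≠ 0 := (map_ne_zero σ).mpr hc0
        simp only [Fin.cons_zero, h_smul, h_smul', ← hc, map_inv₀, if_true]
        field_simp
      · simp [h_smul, hwv, (Fin.succ_ne_zero k).symm]
      · simp [h_smul', hvw, Fin.succ_ne_zero i]
      · simp [hv]
  obtain ⟨v, hv⟩ := main n le_rfl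
  refine ⟨Matrix.of v, ?_⟩
  ext i k
  rw [Matrix.one_apply, ← hv i k, Matrix.mul_assoc]
  simp only [hh, Matrix.mul_apply, dotProduct, Matrix.mulVec, Matrix.of_apply,
    Matrix.transpose_apply, Matrix.map_apply]

/-! ### Twisted tori in the special linear and the special unitary group -/

/-- The transpose of a Vandermonde matrix with distinct nodes is invertible; here its columns are
indexed by the nodes. -/
theorem exists_vandermonde_inverse {Ω ι : Type*} [Field Ω] [Fintype ι] [DecidableEq ι] {n : ℕ}
    (hn : Fintype.card ι = n) {z : ι → Ω} (hz : Function.Injective z) :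
    ∃ W : Matrix ι (Fin n) Ω, (Matrix.of fun (k : Fin n) i => z i ^ (k : ℕ)) * W = 1 ∧
      W * (Matrix.of fun (k : Fin n) i => z i ^ (k : ℕ)) = 1 := by
  let e : Fin n ≃ ι := (Fintype.equivFinOfCardEq hn).symm
  set A := (Matrix.vandermonde (z ∘ e)).transpose with hA
  have hdet : IsUnit A.det := by
    rw [hA, Matrix.det_transpose, isUnit_iff_ne_zero, Matrix.det_vandermonde_ne_zero_iff]
    exact hz.comp e.injective
  have hV : (Matrix.of fun (k : Fin n) i => z i ^ (k : ℕ)) = A.submatrix id e.symm := by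
    ext k i
    simp [hA, Matrix.vandermonde_apply]
  refine ⟨A⁻¹.submatrix e.symm id, ?_, ?_⟩
  · rw [hV, Matrix.submatrix_mul_equiv, Matrix.mul_nonsing_inv _ hdet, Matrix.submatrix_id_id]
  · rw [hV]
    have := Matrix.submatrix_mul_equiv A⁻¹ A e.symm (Equiv.refl (Fin n)) e.symm
    rw [Matrix.nonsing_inv_mul _ hdet, Matrix.submatrix_one_equiv] at this
    exact this

/-- Permuting the eigenvectors permutes the eigenvalues. -/
theorem submatrix_mul_diagonal_mul_submatrix {Ω ι : Type*} [Field Ω] [Fintype ι] [DecidableEq ι]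
    {n : ℕ} (Z : Matrix (Fin n) ι Ω) (Y : Matrix ι (Fin n) Ω) (π : Equiv.Perm ι) (d : ι → Ω) :
    Z.submatrix id π * Matrix.diagonal d * Y.submatrix π id =
      Z * Matrix.diagonal (d ∘ π.symm) * Y := by
  have h : Matrix.diagonal d = (Matrix.diagonal (d ∘ π.symm)).submatrix π π := by
    rw [Matrix.submatrix_diagonal_equiv]
    congr 1
    ext i
    simp
  rw [h, Matrix.submatrix_mul_equiv, Matrix.submatrix_mul_equiv, Matrix.submatrix_id_id]

theorem mul_diagonal_mul_inj {Ω ι : Type*} [Field Ω] [Fintype ι] [DecidableEq ι]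
    {n : ℕ} {Z : Matrix (Fin n) ι Ω} {Y : Matrix ι (Fin n) Ω} (hYZ : Y * Z = 1) {d d' : ι → Ω} :
    Z * Matrix.diagonal d * Y = Z * Matrix.diagonal d' * Y ↔ d = d' := by
  refine ⟨fun h => ?_, fun h => by rw [h]⟩
  have h3 : ∀ D : Matrix ι ι Ω, Y * (Z * D * Y) * Z = D := fun D => by
    rw [← Matrix.mul_assoc, ← Matrix.mul_assoc, hYZ, Matrix.one_mul, Matrix.mul_assoc, hYZ,
      Matrix.mul_one]
  have h2 : Y * (Z * Matrix.diagonal d * Y) * Z = Y * (Z * Matrix.diagonal d' * Y) * Z := by rw [h]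
  rw [h3, h3] at h2
  exact Matrix.diagonal_injective h2

/-- If the image of `G` consists of the matrices of determinant one on which a condition `P` holds,
it suffices to compare `P` with the twisting condition for conjugates of diagonal matrices. -/
theorem ContainsTwistedTorus.of_forall {G ι Ω : Type*} [Group G] [Field Ω] [Fintype ι]
    [DecidableEq ι] {n : ℕ} {j : G →* Matrix.SpecialLinearGroup (Fin n) Ω} {π : Equiv.Perm ι}
    {Q : ℤ} {P : Matrix (Fin n) (Fin n) Ω → Prop} (hP : ∀ A, A ∈ j.range ↔ P A.1)
    {Z : Matrix (Fin n) ι Ω} {Y : Matrix ι (Fin n) Ω} (hZY : Z * Y = 1) (hYZ : Y * Z = 1)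
    (h : ∀ d : ι → Ωˣ, P (Z * Matrix.diagonal (fun i => (d i : Ω)) * Y) ↔
      ∀ i, d (π i) = d i ^ Q) :
    ContainsTwistedTorus j π Q := by
  refine ⟨Z, Y, hZY, hYZ, fun d => ?_⟩
  have hdet : (Z * Matrix.diagonal (fun i => (d i : Ω)) * Y).det = ((∏ i, d i : Ωˣ) : Ω) := by
    rw [Matrix.det_conj_of_mul_eq_one hZY hYZ, Matrix.det_diagonal, Units.coe_prod]
  constructor
  · rintro ⟨g, hg⟩
    refine ⟨(h d).mp ?_, ?_⟩
    · rw [← hg]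
      exact (hP (j g)).mp ⟨g, rfl⟩
    · rw [Units.ext_iff, ← hdet, ← hg]
      exact (j g).2
  · rintro ⟨h1, h2⟩
    have hdet' : (Z * Matrix.diagonal (fun i => (d i : Ω)) * Y).det = 1 := by
      rw [hdet, h2, Units.val_one]
    obtain ⟨g, hg⟩ := (hP ⟨_, hdet'⟩).mpr ((h d).mpr h1)
    exact ⟨g, by rw [hg]⟩

theorem forall_eq_comp_symm_iff {ι X : Type*} (π : Equiv.Perm ι) (f g : ι → X) :
    f = g ∘ π.symm ↔ ∀ i, f (π i) = g i := by
  constructor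
  · rintro rfl i
    simp
  · intro h
    ext i
    simpa using h (π.symm i)

/-- The special linear group over the field of `q` elements contains the twisted torus of `π` and
`q`, provided that there are distinct nodes permuted by the `q`-Frobenius in the same way as
their indices by `π`: the Vandermonde matrix of the nodes conjugates the torus into the group. -/
theorem containsTwistedTorus_of_range_eq_map_eq {G ι Ω : Type*} [Group G] [Field Ω] [Fintype ι]
    [DecidableEq ι] {n q : ℕ} {j : G →* Matrix.SpecialLinearGroup (Fin n) Ω} {π : Equiv.Perm ι}
    (φ : Ω →+* Ω) (hφ : ∀ x, φ x = x ^ q)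
    (hj : ∀ A : Matrix.SpecialLinearGroup (Fin n) Ω, A ∈ j.range ↔ A.1.map φ = A.1)
    (hn : Fintype.card ι = n) {z : ι → Ω} (hz : Function.Injective z)
    (hzπ : ∀ i, z (π i) = z i ^ q) :
    ContainsTwistedTorus j π q := by
  obtain ⟨W, hVW, hWV⟩ := exists_vandermonde_inverse hn hz
  set V : Matrix (Fin n) ι Ω := Matrix.of fun (k : Fin n) i => z i ^ (k : ℕ) with hV
  have hVφ : V.map φ = V.submatrix id π := by
    ext k i
    simp only [hV, Matrix.map_apply, Matrix.of_apply, Matrix.submatrix_apply, id, hzπ, hφ]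
    exact pow_right_comm _ _ _
  have hWφ : W.map φ = W.submatrix π id := by
    have h1 : W.map φ * V.submatrix id π = 1 := by
      rw [← hVφ, ← Matrix.map_mul, hWV, Matrix.map_one _ (map_zero φ) (map_one φ)]
    have h2 : V.submatrix id π * W.submatrix π id = 1 := by
      rw [Matrix.submatrix_mul_equiv, hVW, Matrix.submatrix_id_id]
    calc W.map φ = W.map φ * (V.submatrix id π * W.submatrix π id) := by rw [h2, Matrix.mul_one]
      _ = W.submatrix π id := by rw [← Matrix.mul_assoc, h1, Matrix.one_mul]
  refine ContainsTwistedTorus.of_forall (P := fun A => A.map φ = A) hj hVW hWV fun d => ?_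
  rw [Matrix.map_mul, Matrix.map_mul, hVφ, hWφ, Matrix.diagonal_map (map_zero φ),
    submatrix_mul_diagonal_mul_submatrix, mul_diagonal_mul_inj hWV, eq_comm,
    forall_eq_comp_symm_iff]
  simp [hφ, Units.ext_iff]

/-- The special unitary group over the field of `q ^ 2` elements contains the twisted torus of `π`
and `-q`, under the same condition on nodes as for the special linear group. If `V` is the
Vandermonde matrix of the nodes, then `V * Vᵀ` is hermitian, because the Frobenius permutes the
columns of `V`. If `B` transforms it to the identity, then `B * V` conjugates the torus into the
group. -/
theorem containsTwistedTorus_of_range_eq_unitary {G ι Ω K : Type*} [Group G] [Field Ω] [Field K]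
    [Fintype ι] [DecidableEq ι] {n q : ℕ} {j : G →* Matrix.SpecialLinearGroup (Fin n) Ω}
    {π : Equiv.Perm ι} (φ : Ω →+* Ω) (hφ : ∀ x, φ x = x ^ q) (σ : K →+* K) (e : K →+* Ω)
    (heσ : ∀ x, e (σ x) = φ (e x)) (he : ∀ x, φ (φ x) = x ↔ x ∈ e.range)
    (hne : ∃ x, x + σ x ≠ 0) (hnorm : ∀ c, σ c = c → ∃ x, x * σ x = c)
    (hj : ∀ A : Matrix.SpecialLinearGroup (Fin n) Ω,
      A ∈ j.range ↔ A.1 * (A.1.map φ).transpose = 1)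
    (hn : Fintype.card ι = n) {z : ι → Ω} (hz : Function.Injective z)
    (hzπ : ∀ i, z (π i) = z i ^ q) :
    ContainsTwistedTorus j π (-q) := by
  obtain ⟨W, hVW, hWV⟩ := exists_vandermonde_inverse hn hz
  set V : Matrix (Fin n) ι Ω := Matrix.of fun (k : Fin n) i => z i ^ (k : ℕ) with hV
  have hVφ : V.map φ = V.submatrix id π := by
    ext k i
    simp only [hV, Matrix.map_apply, Matrix.of_apply, Matrix.submatrix_apply, id, hzπ, hφ]
    exact pow_right_comm _ _ _
  have hHφ : (V * V.transpose).map φ = V * V.transpose := by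
    rw [Matrix.map_mul, Matrix.transpose_map, hVφ, Matrix.transpose_submatrix,
      Matrix.submatrix_mul_equiv, Matrix.submatrix_id_id]
  -- `V * Vᵀ` is symmetric with entries in the field of `q` elements, hence hermitian
  have hfix : ∀ i k, φ ((V * V.transpose) i k) = (V * V.transpose) i k := fun i k =>
    congrFun (congrFun hHφ i) k
  choose H hH using fun i k => (he ((V * V.transpose) i k)).mp (by rw [hfix, hfix])
  have hHe : (Matrix.of H).map e = V * V.transpose := by
    ext i k
    exact hH i k
  have hHσ : ((Matrix.of H).map σ).transpose = Matrix.of H := by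
    ext i k
    apply e.injective
    simp only [Matrix.transpose_apply, Matrix.map_apply, Matrix.of_apply, heσ, hH, hfix]
    rw [← Matrix.transpose_apply (V * V.transpose) i k, Matrix.transpose_mul,
      Matrix.transpose_transpose]
  have hHdet : IsUnit (Matrix.of H).det := by
    rw [isUnit_iff_ne_zero]
    intro h0
    have h1 : (V * V.transpose).det = 0 := by
      rw [← hHe, ← RingHom.mapMatrix_apply, ← RingHom.map_det, h0, map_zero]
    have h2 : (V * V.transpose) * (W.transpose * W) = 1 := by
      calc (V * V.transpose) * (W.transpose * W) = V * (V.transpose * W.transpose) * W := by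
            simp only [Matrix.mul_assoc]
        _ = 1 := by rw [← Matrix.transpose_mul, hWV, Matrix.transpose_one, Matrix.mul_one, hVW]
    have h3 := congrArg Matrix.det h2
    rw [Matrix.det_mul, h1, zero_mul, Matrix.det_one] at h3
    exact zero_ne_one h3
  have hσσ : ∀ x, σ (σ x) = x := fun x => by
    apply e.injective
    rw [heσ, heσ]
    exact (he (e x)).mpr ⟨x, rfl⟩
  obtain ⟨B₀, hB₀⟩ := exists_mul_mul_map_transpose_eq_one σ hσσ hne hnorm (Matrix.of H) hHσ hHdet
  set B := B₀.map e with hB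
  set B' := (B.map φ).transpose with hB'
  have hBB : B * (V * V.transpose) * B' = 1 := by
    have h1 : B' = ((B₀.map σ).transpose).map e := by
      ext i k
      simp [hB', hB, heσ]
    rw [h1, hB, ← hHe, ← Matrix.map_mul, ← Matrix.map_mul, hB₀,
      Matrix.map_one _ (map_zero e) (map_one e)]
  have hB'B : (B'.map φ).transpose = B := by
    ext i k
    simp only [hB', hB, Matrix.transpose_apply, Matrix.map_apply]
    exact (he _).mpr ⟨_, rfl⟩
  set Z := B * V with hZ
  set Y := V.transpose * B' with hY
  have hZY : Z * Y = 1 := by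
    rw [hZ, hY, ← hBB]
    simp only [Matrix.mul_assoc]
  have hYZ : Y * Z = 1 := by
    have h1 : (B' * B) * (V * V.transpose) = 1 := by
      rw [Matrix.mul_assoc]
      exact mul_eq_one_comm.mp hBB
    calc Y * Z = W * V * (Y * Z) := by rw [hWV, Matrix.one_mul]
      _ = W * ((V * V.transpose) * (B' * B)) * V := by
          rw [hY, hZ]
          simp only [Matrix.mul_assoc]
      _ = 1 := by rw [mul_eq_one_comm.mp h1, Matrix.mul_one, hWV]
  have hZφ : (Z.map φ).transpose = Y.submatrix π id := by
    rw [hZ, Matrix.map_mul, Matrix.transpose_mul, hVφ, hY, Matrix.transpose_submatrix]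
    rfl
  have hYφ : (Y.map φ).transpose = Z.submatrix id π := by
    rw [hY, Matrix.map_mul, Matrix.transpose_mul, hB'B, ← Matrix.transpose_map,
      Matrix.transpose_transpose, hVφ, hZ]
    rfl
  refine ContainsTwistedTorus.of_forall (P := fun A => A * (A.map φ).transpose = 1) hj hZY hYZ
    fun d => ?_
  rw [Matrix.map_mul, Matrix.map_mul, Matrix.transpose_mul, Matrix.transpose_mul, hZφ, hYφ,
    Matrix.diagonal_map (map_zero φ), Matrix.diagonal_transpose,
    ← Matrix.mul_assoc (Z.submatrix _ _), submatrix_mul_diagonal_mul_submatrix]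
  set d' : ι → Ω := (fun i => φ (d i : Ω)) ∘ π.symm with hd'
  have h1 : Z * Matrix.diagonal (fun i => (d i : Ω)) * Y * (Z * Matrix.diagonal d' * Y) =
      Z * Matrix.diagonal (fun i => (d i : Ω) * d' i) * Y := by
    calc _ = Z * Matrix.diagonal (fun i => (d i : Ω)) * (Y * Z) * Matrix.diagonal d' * Y := by
          simp only [Matrix.mul_assoc]
      _ = _ := by
          rw [hYZ, Matrix.mul_one, Matrix.mul_assoc Z, Matrix.diagonal_mul_diagonal]
  have h2 : (1 : Matrix (Fin n) (Fin n) Ω) = Z * Matrix.diagonal (fun _ : ι => (1 : Ω)) * Y := by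
    rw [Matrix.diagonal_one, Matrix.mul_one, hZY]
  rw [h1, h2, mul_diagonal_mul_inj hYZ, funext_iff]
  rw [← π.forall_congr_right]
  refine forall_congr' fun i => ?_
  simp only [hd', Function.comp_apply, Equiv.symm_apply_apply, hφ, zpow_neg, zpow_natCast]
  rw [eq_inv_iff_mul_eq_one, Units.ext_iff]
  simp

/-! ### Cyclic orbits of a power map -/

section PowerMap

theorem iterate_zpow {A : Type*} [DivisionCommMonoid A] (Q : ℤ) (i : ℕ) (x : A) :
    (fun y : A => y ^ Q)^[i] x = x ^ Q ^ i := by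
  induction i with
  | zero => simp
  | succ i ih => rw [Function.iterate_succ_apply', ih, pow_succ, zpow_mul]

theorem isPeriodicPt_zpow_iff {A : Type*} [CommGroup A] (Q : ℤ) (a : ℕ) (x : A) :
    Function.IsPeriodicPt (fun y : A => y ^ Q) a x ↔ x ^ (Q ^ a - 1) = 1 := by
  rw [Function.IsPeriodicPt, Function.IsFixedPt, iterate_zpow, zpow_sub, zpow_one,
    mul_inv_eq_one]

/-- A function on `Fin a` along which `i ↦ i + 1` corresponds to the map `ψ` runs through an orbit
of `ψ`. -/
theorem eq_iterate_of_forall_add_one {X : Type*} {a : ℕ} [NeZero a] {ψ : X → X} {f : Fin a → X}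
    (hf : ∀ i, f (i + 1) = ψ (f i)) :
    Function.IsPeriodicPt ψ a (f 0) ∧ ∀ i : Fin a, f i = ψ^[(i : ℕ)] (f 0) := by
  have h : ∀ k : ℕ, f (Fin.ofNat a k) = ψ^[k] (f 0) := by
    intro k
    induction k with
    | zero => rfl
    | succ k ih =>
      rw [Function.iterate_succ_apply', ← ih, ← hf]
      congr 1
      ext
      simp [Fin.val_add]
  refine ⟨?_, fun i => ?_⟩
  · have h1 := h a
    have h2 : Fin.ofNat a a = 0 := by ext; simp
    rw [h2] at h1
    exact h1.symm
  · rw [← h i]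
    congr 1
    ext
    simp

theorem iterate_add_one_of_isPeriodicPt {X : Type*} {a : ℕ} [NeZero a] {ψ : X → X} {x : X}
    (hx : Function.IsPeriodicPt ψ a x) (i : Fin a) :
    ψ^[((i + 1 : Fin a) : ℕ)] x = ψ (ψ^[(i : ℕ)] x) := by
  rw [← Function.iterate_succ_apply' ψ, ← hx.iterate_mod_apply (i + 1)]
  congr 1
  simp [Fin.val_add]

theorem injective_iterate_iff {X : Type*} {a : ℕ} [NeZero a] {ψ : X → X} {x : X}
    (hx : Function.IsPeriodicPt ψ a x) :
    (Function.Injective fun i : Fin a => ψ^[(i : ℕ)] x) ↔ Function.minimalPeriod ψ x = a := by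
  have ha : 0 < a := Nat.pos_of_ne_zero (NeZero.ne a)
  constructor
  · intro h
    by_contra hne
    have hlt : Function.minimalPeriod ψ x < a := lt_of_le_of_ne (hx.minimalPeriod_le ha) hne
    have hpos := hx.minimalPeriod_pos ha
    have h1 := @h ⟨_, hlt⟩ ⟨0, ha⟩ (Function.isPeriodicPt_minimalPeriod ψ x)
    rw [Fin.mk.injEq] at h1
    omega
  · intro h i k hik
    refine Fin.ext (Function.iterate_injOn_Iio_minimalPeriod (f := ψ) (x := x) ?_ ?_ hik)
    · rw [Set.mem_Iio, h]; exact i.isLt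
    · rw [Set.mem_Iio, h]; exact k.isLt

variable {Ω : Type*} [Field Ω]

theorem zpow_eq_one_iff_mem_rootsOfUnity (z : ℤ) (x : Ωˣ) :
    x ^ z = 1 ↔ x ∈ rootsOfUnity z.natAbs Ω := by
  rw [mem_rootsOfUnity]
  obtain ⟨m, rfl | rfl⟩ := z.eq_nat_or_neg <;> simp

theorem setOf_zpow_eq_one (z : ℤ) :
    {x : Ωˣ | x ^ z = 1} = (rootsOfUnity z.natAbs Ω : Set Ωˣ) := by
  ext x
  exact zpow_eq_one_iff_mem_rootsOfUnity z x

theorem finite_setOf_zpow_eq_one {z : ℤ} (hz : z ≠ 0) : {x : Ωˣ | x ^ z = 1}.Finite := by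
  have : NeZero z.natAbs := ⟨Int.natAbs_ne_zero.mpr hz⟩
  rw [setOf_zpow_eq_one]
  exact Set.finite_coe_iff.mp (inferInstanceAs (Finite (rootsOfUnity z.natAbs Ω)))

theorem ncard_setOf_zpow_eq_one_le {z : ℤ} (hz : z ≠ 0) :
    {x : Ωˣ | x ^ z = 1}.ncard ≤ z.natAbs := by
  have : NeZero z.natAbs := ⟨Int.natAbs_ne_zero.mpr hz⟩
  rw [setOf_zpow_eq_one]
  exact card_rootsOfUnity Ω z.natAbs

theorem card_rootsOfUnity_natAbs [IsAlgClosed Ω] {z : ℤ} (hz : (z : Ω) ≠ 0) :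
    Nat.card (rootsOfUnity z.natAbs Ω) = z.natAbs := by
  have h : (z.natAbs : Ω) ≠ 0 := by
    obtain ⟨m, rfl | rfl⟩ := z.eq_nat_or_neg <;> simpa using hz
  have : NeZero (z.natAbs : Ω) := ⟨h⟩
  have : NeZero z.natAbs := NeZero.of_neZero_natCast Ω
  exact HasEnoughRootsOfUnity.natCard_rootsOfUnity Ω z.natAbs

/-- For `x` in a finite set `A` there are at most `|s|` solutions `y` of `x ^ r * y ^ s = 1`. -/
theorem ncard_prod_zpow_eq_one_le {A : Set Ωˣ} (hA : A.Finite) (r : ℤ) {s : ℤ} (hs : s ≠ 0) :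
    {u : Ωˣ × Ωˣ | u.1 ∈ A ∧ u.1 ^ r * u.2 ^ s = 1}.Finite ∧
      {u : Ωˣ × Ωˣ | u.1 ∈ A ∧ u.1 ^ r * u.2 ^ s = 1}.ncard ≤ A.ncard * s.natAbs := by
  classical
  let y₀ : Ωˣ → Ωˣ := fun x => if h : ∃ y : Ωˣ, x ^ r * y ^ s = 1 then h.choose else 1
  let F : Ωˣ × Ωˣ → Ωˣ × Ωˣ := fun u => (u.1, u.2 / y₀ u.1)
  have hF : Function.Injective F := by
    rintro ⟨x, y⟩ ⟨x', y'⟩ h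
    simp only [F, Prod.mk.injEq] at h
    obtain ⟨rfl, h⟩ := h
    simpa using h
  have hfin : (A ×ˢ {x : Ωˣ | x ^ s = 1}).Finite := hA.prod (finite_setOf_zpow_eq_one hs)
  have hmaps : ∀ u ∈ {u : Ωˣ × Ωˣ | u.1 ∈ A ∧ u.1 ^ r * u.2 ^ s = 1},
      F u ∈ A ×ˢ {x : Ωˣ | x ^ s = 1} := by
    rintro ⟨x, y⟩ ⟨hx, hy⟩
    refine ⟨hx, ?_⟩
    have hex : ∃ y : Ωˣ, x ^ r * y ^ s = 1 := ⟨y, hy⟩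
    have h2 : x ^ r * y₀ x ^ s = 1 := by
      simp only [y₀, dif_pos hex]
      exact hex.choose_spec
    change (y / y₀ x) ^ s = 1
    rw [div_zpow, div_eq_one]
    exact mul_left_cancel (hy.trans h2.symm)
  refine ⟨Set.Finite.of_injOn hmaps hF.injOn hfin, ?_⟩
  refine (Set.ncard_le_ncard_of_injOn F hmaps hF.injOn hfin).trans ?_
  rw [Set.ncard_prod]
  exact Nat.mul_le_mul_left _ (ncard_setOf_zpow_eq_one_le hs)

/-- The elements `x` in the fixed group of the `a`-fold iterate of `x ↦ x ^ Q` whose orbit has fewer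
than `a` elements. -/
def shortOrbits (Ω : Type*) [Field Ω] (Q : ℤ) (a : ℕ) : Set Ωˣ :=
  {x | Function.IsPeriodicPt (fun y : Ωˣ => y ^ Q) a x ∧
    Function.minimalPeriod (fun y : Ωˣ => y ^ Q) x ≠ a}

theorem pow_sub_one_ne_zero {Q : ℤ} (hQ : 2 ≤ Q.natAbs) {a : ℕ} (ha : a ≠ 0) : Q ^ a - 1 ≠ 0 := by
  intro h
  have h1 : (Q ^ a).natAbs = 1 := by
    rw [sub_eq_zero.mp h]; rfl
  rw [Int.natAbs_pow] at h1
  have := Nat.one_lt_pow ha (by omega : 1 < Q.natAbs)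
  omega

theorem natAbs_pow_sub_one_le (Q : ℤ) (a : ℕ) : (Q ^ a - 1).natAbs ≤ Q.natAbs ^ a + 1 := by
  have h := Int.natAbs_sub_le (Q ^ a) 1
  rwa [Int.natAbs_pow] at h

theorem le_natAbs_pow_sub_one (Q : ℤ) (a : ℕ) : Q.natAbs ^ a ≤ (Q ^ a - 1).natAbs + 1 := by
  have h := Int.natAbs_add_le (Q ^ a - 1) 1
  rw [sub_add_cancel, Int.natAbs_pow] at h
  simpa using h

theorem exists_period_le_half {X : Type*} {ψ : X → X} {x : X} {a : ℕ} (ha : a ≠ 0)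
    (hx : Function.IsPeriodicPt ψ a x) (hne : Function.minimalPeriod ψ x ≠ a) :
    ∃ d ∈ Finset.Icc 1 (a / 2), Function.IsPeriodicPt ψ d x := by
  have hpos := hx.minimalPeriod_pos (Nat.pos_of_ne_zero ha)
  obtain ⟨c, hc⟩ := hx.minimalPeriod_dvd
  refine ⟨_, Finset.mem_Icc.mpr ⟨hpos, ?_⟩, Function.isPeriodicPt_minimalPeriod ψ x⟩
  rw [Nat.le_div_iff_mul_le (by norm_num)]
  have hc2 : 2 ≤ c := by
    rcases c with _ | _ | c
    · simp at hc; omega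
    · simp at hc; omega
    · omega
  calc _ ≤ Function.minimalPeriod ψ x * c := Nat.mul_le_mul_left _ hc2
    _ = a := hc.symm

theorem shortOrbits_subset (Q : ℤ) {a : ℕ} (ha : a ≠ 0) :
    shortOrbits Ω Q a ⊆ ⋃ d ∈ Finset.Icc 1 (a / 2), {x : Ωˣ | x ^ (Q ^ d - 1) = 1} := by
  rintro x ⟨hx, hne⟩
  obtain ⟨d, hd, hxd⟩ := exists_period_le_half ha hx hne
  exact Set.mem_biUnion hd ((isPeriodicPt_zpow_iff Q d x).mp hxd)

theorem finite_biUnion_zpow_eq_one {Q : ℤ} (hQ : 2 ≤ Q.natAbs) (I : Finset ℕ)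
    (hI : ∀ d ∈ I, d ≠ 0) : (⋃ d ∈ I, {x : Ωˣ | x ^ (Q ^ d - 1) = 1}).Finite :=
  Set.Finite.biUnion I.finite_toSet fun d hd =>
    finite_setOf_zpow_eq_one (pow_sub_one_ne_zero hQ (hI d hd))

theorem ncard_biUnion_zpow_eq_one_le {Q : ℤ} (hQ : 2 ≤ Q.natAbs) (I : Finset ℕ)
    (hI : ∀ d ∈ I, d ≠ 0) :
    (⋃ d ∈ I, {x : Ωˣ | x ^ (Q ^ d - 1) = 1}).ncard ≤ ∑ d ∈ I, (Q.natAbs ^ d + 1) := by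
  refine (Finset.set_ncard_biUnion_le _ _).trans (Finset.sum_le_sum fun d hd => ?_)
  exact (ncard_setOf_zpow_eq_one_le (pow_sub_one_ne_zero hQ (hI d hd))).trans
    (natAbs_pow_sub_one_le Q d)

theorem finite_shortOrbits {Q : ℤ} (hQ : 2 ≤ Q.natAbs) {a : ℕ} (ha : a ≠ 0) :
    (shortOrbits Ω Q a).Finite :=
  (finite_biUnion_zpow_eq_one hQ _ fun d hd => by
    have := (Finset.mem_Icc.mp hd).1; omega).subset (shortOrbits_subset Q ha)

theorem ncard_shortOrbits_le {Q : ℤ} (hQ : 2 ≤ Q.natAbs) {a : ℕ} (ha : a ≠ 0) :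
    (shortOrbits Ω Q a).ncard ≤ ∑ d ∈ Finset.Icc 1 (a / 2), (Q.natAbs ^ d + 1) := by
  have hI : ∀ d ∈ Finset.Icc 1 (a / 2), d ≠ 0 := fun d hd => by
    have := (Finset.mem_Icc.mp hd).1; omega
  exact (Set.ncard_le_ncard (shortOrbits_subset Q ha) (finite_biUnion_zpow_eq_one hQ _ hI)).trans
    (ncard_biUnion_zpow_eq_one_le hQ _ hI)

/-- An orbit of length exactly `a`: a root of unity of order `q ^ a - 1`. -/
theorem exists_minimalPeriod_pow_eq [IsAlgClosed Ω] {q a : ℕ} (hq : 2 ≤ q) (hqΩ : (q : Ω) = 0)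
    (ha : a ≠ 0) :
    ∃ x : Ω, Function.IsPeriodicPt (fun y : Ω => y ^ q) a x ∧
      Function.minimalPeriod (fun y : Ω => y ^ q) x = a := by
  have hit : ∀ (i : ℕ) (x : Ω), (fun y : Ω => y ^ q)^[i] x = x ^ q ^ i := by
    intro i x
    induction i with
    | zero => simp
    | succ i ih => rw [Function.iterate_succ_apply', ih, pow_succ, pow_mul]
  have h1 : 1 < q ^ a := Nat.one_lt_pow ha (by omega)
  have : NeZero ((q ^ a - 1 : ℕ) : Ω) := ⟨by
    rw [Nat.cast_sub h1.le, Nat.cast_pow, hqΩ, zero_pow ha]; simp⟩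
  obtain ⟨x, hx⟩ := HasEnoughRootsOfUnity.exists_primitiveRoot Ω (q ^ a - 1)
  have hx0 : x ≠ 0 := hx.ne_zero (by omega)
  have hper : ∀ d, Function.IsPeriodicPt (fun y : Ω => y ^ q) d x ↔ q ^ a - 1 ∣ q ^ d - 1 := by
    intro d
    have h2 : 1 ≤ q ^ d := Nat.one_le_pow _ _ (by omega)
    rw [Function.IsPeriodicPt, Function.IsFixedPt, hit, ← hx.pow_eq_one_iff_dvd]
    conv_lhs => rw [← Nat.sub_add_cancel h2, pow_succ]
    exact mul_eq_right₀ hx0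
  have hxa : Function.IsPeriodicPt (fun y : Ω => y ^ q) a x := (hper a).mpr dvd_rfl
  refine ⟨x, hxa, le_antisymm (hxa.minimalPeriod_le (Nat.pos_of_ne_zero ha)) ?_⟩
  have hpos := hxa.minimalPeriod_pos (Nat.pos_of_ne_zero ha)
  have h3 := (hper _).mp (Function.isPeriodicPt_minimalPeriod (fun y : Ω => y ^ q) x)
  have h4 : 1 < q ^ Function.minimalPeriod (fun y : Ω => y ^ q) x :=
    Nat.one_lt_pow hpos.ne' (by omega)
  have h5 := Nat.le_of_dvd (by omega) h3
  exact (Nat.pow_le_pow_iff_right (by omega : 1 < q)).mp (by omega)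

theorem intCast_pow_sub_one_ne_zero {Q : ℤ} (hQ : (Q : Ω) = 0) {a : ℕ} (ha : a ≠ 0) :
    ((Q ^ a - 1 : ℤ) : Ω) ≠ 0 := by
  push_cast
  rw [hQ, zero_pow ha]
  simp

theorem intCast_geom_sum_ne_zero {Q : ℤ} (hQ : (Q : Ω) = 0) {a : ℕ} (ha : a ≠ 0) :
    ((∑ i ∈ Finset.range a, Q ^ i : ℤ) : Ω) ≠ 0 := by
  intro h
  apply intCast_pow_sub_one_ne_zero hQ ha
  rw [← geom_sum_mul, Int.cast_mul, h, zero_mul]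

theorem geom_sum_ne_zero_of_two_le_natAbs {Q : ℤ} (hQ : 2 ≤ Q.natAbs) {a : ℕ} (ha : a ≠ 0) :
    ∑ i ∈ Finset.range a, Q ^ i ≠ 0 := by
  intro h
  apply pow_sub_one_ne_zero hQ ha
  rw [← geom_sum_mul, h, zero_mul]

theorem prod_iterate_zpow {A : Type*} [CommGroup A] (Q : ℤ) (a : ℕ) (x : A) :
    ∏ i : Fin a, (fun y : A => y ^ Q)^[(i : ℕ)] x = x ^ ∑ i ∈ Finset.range a, Q ^ i := by
  simp only [iterate_zpow]
  rw [Fin.prod_univ_eq_prod_range (fun i => x ^ Q ^ i) a]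
  induction a with
  | zero => simp
  | succ a ih => rw [Finset.prod_range_succ, Finset.sum_range_succ, zpow_add, ih]

end PowerMap

/-! ### The torus of an `n`-cycle -/

section Cycle

variable {Ω : Type*} [Field Ω] {Q : ℤ} {n : ℕ} [NeZero n]

theorem apply_eq_iterate_of_mem_cycle {d : Fin n → Ωˣ}
    (hd : d ∈ twistedTorus Ω (Equiv.addRight (1 : Fin n)) Q) :
    Function.IsPeriodicPt (fun y : Ωˣ => y ^ Q) n (d 0) ∧
      ∀ i : Fin n, d i = (fun y : Ωˣ => y ^ Q)^[(i : ℕ)] (d 0) :=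
  eq_iterate_of_forall_add_one (ψ := fun y : Ωˣ => y ^ Q) hd.1

/-- An element of the torus of an `n`-cycle is determined by one of its entries. -/
theorem apply_zero_injective_cycle :
    Function.Injective fun t : twistedTorus Ω (Equiv.addRight (1 : Fin n)) Q => t.1 0 := by
  intro t t' h
  ext i
  have h : t.1 0 = t'.1 0 := h
  rw [(apply_eq_iterate_of_mem_cycle t.2).2 i, (apply_eq_iterate_of_mem_cycle t'.2).2 i, h]

theorem card_le_card_twistedTorus_cycle [IsAlgClosed Ω] (hQΩ : (Q : Ω) = 0)
    [Finite (twistedTorus Ω (Equiv.addRight (1 : Fin n)) Q)] :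
    (∑ i ∈ Finset.range n, Q ^ i).natAbs ≤
      Nat.card (twistedTorus Ω (Equiv.addRight (1 : Fin n)) Q) := by
  rw [← card_rootsOfUnity_natAbs (intCast_geom_sum_ne_zero hQΩ (NeZero.ne n))]
  have hmem : ∀ x : rootsOfUnity (∑ i ∈ Finset.range n, Q ^ i).natAbs Ω,
      (fun i : Fin n => (fun y : Ωˣ => y ^ Q)^[(i : ℕ)] x.1) ∈
        twistedTorus Ω (Equiv.addRight (1 : Fin n)) Q := by
    intro x
    have hx := (zpow_eq_one_iff_mem_rootsOfUnity _ x.1).mpr x.2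
    have hper : Function.IsPeriodicPt (fun y : Ωˣ => y ^ Q) n x.1 := by
      rw [isPeriodicPt_zpow_iff, ← geom_sum_mul, zpow_mul, hx, one_zpow]
    exact ⟨fun i => iterate_add_one_of_isPeriodicPt hper i, by rw [prod_iterate_zpow, hx]⟩
  refine Nat.card_le_card_of_injective (fun x => ⟨_, hmem x⟩) fun x x' h => ?_
  have := congrFun (congrArg Subtype.val h) (0 : Fin n)
  exact Subtype.ext (by simpa using this)

/-- The elements of the torus of an `n`-cycle with repeated entries. Those with all entries equal
are scalar, hence at most `n` in number, which matters for small `n`. -/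
theorem ncard_not_injective_cycle_le (hQ : 2 ≤ Q.natAbs) :
    ({t : twistedTorus Ω (Equiv.addRight (1 : Fin n)) Q | Function.Injective t.1}ᶜ).ncard ≤
      n + ∑ d ∈ Finset.Icc 2 (n / 2), (Q.natAbs ^ d + 1) := by
  have hn := NeZero.ne n
  have hI : ∀ d ∈ Finset.Icc 2 (n / 2), d ≠ 0 := fun d hd => by
    have := (Finset.mem_Icc.mp hd).1; omega
  have hfin := finite_biUnion_zpow_eq_one (Ω := Ω) hQ _ hI
  have hfin' := finite_setOf_zpow_eq_one (Ω := Ω) (z := n) (by exact_mod_cast hn)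
  refine (Set.ncard_le_ncard_of_injOn (t := {x : Ωˣ | x ^ (n : ℤ) = 1} ∪
    ⋃ d ∈ Finset.Icc 2 (n / 2), {x : Ωˣ | x ^ (Q ^ d - 1) = 1}) (fun t => t.1 0) ?_
    apply_zero_injective_cycle.injOn (hfin'.union hfin)).trans
    ((Set.ncard_union_le _ _).trans (add_le_add ?_ (ncard_biUnion_zpow_eq_one_le hQ _ hI)))
  · intro t ht
    obtain ⟨hper, hit⟩ := apply_eq_iterate_of_mem_cycle t.2
    have hne : Function.minimalPeriod (fun y : Ωˣ => y ^ Q) (t.1 0) ≠ n := by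
      intro h
      apply ht
      change Function.Injective t.1
      rw [funext hit]
      exact (injective_iterate_iff hper).mpr h
    obtain ⟨d, hd, hxd⟩ := exists_period_le_half hn hper hne
    obtain ⟨hd1, hd2⟩ := Finset.mem_Icc.mp hd
    rcases hd1.eq_or_lt with rfl | hd1
    · left
      have hfix : ∀ i : ℕ, (fun y : Ωˣ => y ^ Q)^[i] (t.1 0) = t.1 0 := fun i =>
        Function.iterate_fixed hxd i
      have h1 := t.2.2
      rw [funext hit] at h1
      simp only [hfix, Finset.prod_const, Finset.card_univ, Fintype.card_fin] at h1
      change t.1 0 ^ (n : ℤ) = 1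
      rw [zpow_natCast, h1]
    · right
      exact Set.mem_biUnion (Finset.mem_coe.mpr (Finset.mem_Icc.mpr ⟨hd1, hd2⟩))
        ((isPeriodicPt_zpow_iff Q d _).mp hxd)
  · simpa using ncard_setOf_zpow_eq_one_le (Ω := Ω) (z := n) (by exact_mod_cast hn)

theorem ncard_pow_eq_one_cycle_le {m : ℕ} (hm : m ≠ 0) :
    {t : twistedTorus Ω (Equiv.addRight (1 : Fin n)) Q | t ^ m = 1}.ncard ≤ m := by
  have hm' : (m : ℤ) ≠ 0 := by exact_mod_cast hm
  refine (Set.ncard_le_ncard_of_injOn (t := {x : Ωˣ | x ^ (m : ℤ) = 1}) (fun t => t.1 0) ?_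
    apply_zero_injective_cycle.injOn (finite_setOf_zpow_eq_one hm')).trans
    (by simpa using ncard_setOf_zpow_eq_one_le (Ω := Ω) hm')
  intro t ht
  have ht : t ^ m = 1 := ht
  have h := congrFun (congrArg Subtype.val ht) (0 : Fin n)
  simpa using h

theorem ncard_range_eq_cycle_le (r : Fin n → Ωˣ) :
    {t : twistedTorus Ω (Equiv.addRight (1 : Fin n)) Q | Set.range t.1 = Set.range r}.ncard ≤
      n := by
  refine (Set.ncard_le_ncard_of_injOn (t := Set.range r) (fun t => t.1 0) ?_
    apply_zero_injective_cycle.injOn (Set.finite_range r)).trans ?_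
  · intro t ht
    have ht : Set.range t.1 = Set.range r := ht
    rw [← ht]
    exact Set.mem_range_self _
  · rw [← Set.image_univ]
    exact (Set.ncard_image_le Set.finite_univ).trans (by simp [Set.ncard_univ])

theorem exists_nodes_cycle [IsAlgClosed Ω] {q : ℕ} (hq : 2 ≤ q) (hqΩ : (q : Ω) = 0) :
    ∃ z : Fin n → Ω, Function.Injective z ∧ ∀ i, z (Equiv.addRight (1 : Fin n) i) = z i ^ q := by
  obtain ⟨x, hx, hx'⟩ := exists_minimalPeriod_pow_eq hq hqΩ (NeZero.ne n)
  exact ⟨_, (injective_iterate_iff hx).mpr hx', fun i => iterate_add_one_of_isPeriodicPt hx i⟩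

end Cycle

/-! ### The torus of a permutation with two cycles -/

section TwoCycles

/-- The permutation of `Fin a ⊕ Fin b` with the two cycles `Fin a` and `Fin b`. -/
def twoCycles (a b : ℕ) [NeZero a] [NeZero b] : Equiv.Perm (Fin a ⊕ Fin b) :=
  Equiv.sumCongr (Equiv.addRight 1) (Equiv.addRight 1)

/-- A function on two cycles that runs through an orbit of `ψ` of full length on each of them is
injective if the lengths are different. -/
theorem injective_of_minimalPeriod {X : Type*} {a b : ℕ} [NeZero a] [NeZero b] (hab : a ≠ b)
    {ψ : X → X} {f : Fin a ⊕ Fin b → X} {x y : X}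
    (hx : Function.IsPeriodicPt ψ a x) (hy : Function.IsPeriodicPt ψ b y)
    (hx' : Function.minimalPeriod ψ x = a) (hy' : Function.minimalPeriod ψ y = b)
    (hfx : ∀ i : Fin a, f (Sum.inl i) = ψ^[(i : ℕ)] x)
    (hfy : ∀ i : Fin b, f (Sum.inr i) = ψ^[(i : ℕ)] y) : Function.Injective f := by
  have hper : ∀ (i : Fin a) (k : Fin b), f (Sum.inl i) ≠ f (Sum.inr k) := by
    intro i k h
    rw [hfx, hfy] at h
    have h1 := congrArg (Function.minimalPeriod ψ) h
    rw [Function.minimalPeriod_apply_iterate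
        (Function.mk_mem_periodicPts (Nat.pos_of_ne_zero (NeZero.ne a)) hx),
      Function.minimalPeriod_apply_iterate
        (Function.mk_mem_periodicPts (Nat.pos_of_ne_zero (NeZero.ne b)) hy), hx', hy'] at h1
    exact hab h1
  rintro (i | i) (k | k) h
  · rw [hfx, hfx] at h
    rw [(injective_iterate_iff hx).mpr hx' h]
  · exact absurd h (hper i k)
  · exact absurd h.symm (hper k i)
  · rw [hfy, hfy] at h
    rw [(injective_iterate_iff hy).mpr hy' h]

variable {Ω : Type*} [Field Ω] {Q : ℤ} {a b : ℕ} [NeZero a] [NeZero b]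

theorem inl_eq_iterate {d : Fin a ⊕ Fin b → Ωˣ} (hd : d ∈ twistedTorus Ω (twoCycles a b) Q) :
    Function.IsPeriodicPt (fun y : Ωˣ => y ^ Q) a (d (Sum.inl 0)) ∧
      ∀ i : Fin a, d (Sum.inl i) = (fun y : Ωˣ => y ^ Q)^[(i : ℕ)] (d (Sum.inl 0)) :=
  eq_iterate_of_forall_add_one (ψ := fun y : Ωˣ => y ^ Q) (f := d ∘ Sum.inl)
    fun i => hd.1 (Sum.inl i)

theorem inr_eq_iterate {d : Fin a ⊕ Fin b → Ωˣ} (hd : d ∈ twistedTorus Ω (twoCycles a b) Q) :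
    Function.IsPeriodicPt (fun y : Ωˣ => y ^ Q) b (d (Sum.inr 0)) ∧
      ∀ i : Fin b, d (Sum.inr i) = (fun y : Ωˣ => y ^ Q)^[(i : ℕ)] (d (Sum.inr 0)) :=
  eq_iterate_of_forall_add_one (ψ := fun y : Ωˣ => y ^ Q) (f := d ∘ Sum.inr)
    fun i => hd.1 (Sum.inr i)

/-- An element of the torus of two cycles is determined by one entry for each cycle. -/
theorem apply_zero_injective_twoCycles :
    Function.Injective fun t : twistedTorus Ω (twoCycles a b) Q =>
      (t.1 (Sum.inl 0), t.1 (Sum.inr 0)) := by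
  intro t t' h
  obtain ⟨h1, h2⟩ := Prod.mk.inj h
  ext i
  rcases i with i | i
  · rw [(inl_eq_iterate t.2).2 i, (inl_eq_iterate t'.2).2 i, h1]
  · rw [(inr_eq_iterate t.2).2 i, (inr_eq_iterate t'.2).2 i, h2]

theorem zpow_geom_sum_mul_eq_one {d : Fin a ⊕ Fin b → Ωˣ}
    (hd : d ∈ twistedTorus Ω (twoCycles a b) Q) :
    d (Sum.inl 0) ^ (∑ i ∈ Finset.range a, Q ^ i) *
      d (Sum.inr 0) ^ (∑ i ∈ Finset.range b, Q ^ i) = 1 := by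
  rw [← prod_iterate_zpow, ← prod_iterate_zpow, ← hd.2, Fintype.prod_sum_type]
  congr 1
  · exact Finset.prod_congr rfl fun i _ => ((inl_eq_iterate hd).2 i).symm
  · exact Finset.prod_congr rfl fun i _ => ((inr_eq_iterate hd).2 i).symm

theorem exists_nodes_twoCycles [IsAlgClosed Ω] {q : ℕ} (hq : 2 ≤ q) (hqΩ : (q : Ω) = 0)
    (hab : a ≠ b) :
    ∃ z : Fin a ⊕ Fin b → Ω, Function.Injective z ∧ ∀ i, z (twoCycles a b i) = z i ^ q := by
  obtain ⟨x, hx, hx'⟩ := exists_minimalPeriod_pow_eq hq hqΩ (NeZero.ne a)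
  obtain ⟨y, hy, hy'⟩ := exists_minimalPeriod_pow_eq hq hqΩ (NeZero.ne b)
  refine ⟨Sum.elim (fun i => (fun y : Ω => y ^ q)^[(i : ℕ)] x)
    (fun i => (fun y : Ω => y ^ q)^[(i : ℕ)] y),
    injective_of_minimalPeriod hab hx hy hx' hy' (fun _ => rfl) (fun _ => rfl), ?_⟩
  rintro (i | i)
  · exact iterate_add_one_of_isPeriodicPt hx i
  · exact iterate_add_one_of_isPeriodicPt hy i

/-- The torus of two cycles is the kernel of a homomorphism from a product of cyclic groups of
orders `|Q ^ a - 1|` and `|Q ^ b - 1|` to a group of order `|Q - 1|`. -/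
theorem mul_le_card_twistedTorus_twoCycles [IsAlgClosed Ω] (hQΩ : (Q : Ω) = 0)
    (hQ : 2 ≤ Q.natAbs) [Finite (twistedTorus Ω (twoCycles a b) Q)] :
    (Q ^ a - 1).natAbs * (Q ^ b - 1).natAbs ≤
      Nat.card (twistedTorus Ω (twoCycles a b) Q) * (Q - 1).natAbs := by
  have hne1 : Q - 1 ≠ 0 := by simpa using pow_sub_one_ne_zero hQ one_ne_zero
  have hna := intCast_pow_sub_one_ne_zero hQΩ (NeZero.ne a)
  have hnb := intCast_pow_sub_one_ne_zero hQΩ (NeZero.ne b)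
  rw [← card_rootsOfUnity_natAbs hna, ← card_rootsOfUnity_natAbs hnb, ← Nat.card_prod]
  let f : rootsOfUnity (Q ^ a - 1).natAbs Ω × rootsOfUnity (Q ^ b - 1).natAbs Ω →* Ωˣ :=
    ((zpowGroupHom (∑ i ∈ Finset.range a, Q ^ i)).comp
      ((rootsOfUnity _ Ω).subtype.comp (MonoidHom.fst _ _))) *
    ((zpowGroupHom (∑ i ∈ Finset.range b, Q ^ i)).comp
      ((rootsOfUnity _ Ω).subtype.comp (MonoidHom.snd _ _)))
  have hf : ∀ u, f u = u.1.1 ^ (∑ i ∈ Finset.range a, Q ^ i) *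
    u.2.1 ^ (∑ i ∈ Finset.range b, Q ^ i) := fun _ => rfl
  rw [← f.ker.card_mul_index, Subgroup.index_ker]
  refine Nat.mul_le_mul ?_ ?_
  · have hmem : ∀ u : f.ker,
        (Sum.elim (fun i => (fun y : Ωˣ => y ^ Q)^[(i : ℕ)] u.1.1.1)
          (fun i => (fun y : Ωˣ => y ^ Q)^[(i : ℕ)] u.1.2.1) : Fin a ⊕ Fin b → Ωˣ) ∈
          twistedTorus Ω (twoCycles a b) Q := by
      rintro ⟨⟨x, y⟩, hu⟩
      have hx := (isPeriodicPt_zpow_iff Q a x.1).mpr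
        ((zpow_eq_one_iff_mem_rootsOfUnity _ _).mpr x.2)
      have hy := (isPeriodicPt_zpow_iff Q b y.1).mpr
        ((zpow_eq_one_iff_mem_rootsOfUnity _ _).mpr y.2)
      refine ⟨?_, ?_⟩
      · rintro (i | i)
        · exact iterate_add_one_of_isPeriodicPt hx i
        · exact iterate_add_one_of_isPeriodicPt hy i
      · rw [Fintype.prod_sum_type]
        simp only [Sum.elim_inl, Sum.elim_inr]
        rw [prod_iterate_zpow, prod_iterate_zpow]
        exact (MonoidHom.mem_ker.mp hu)
    refine Nat.card_le_card_of_injective (fun u => ⟨_, hmem u⟩) fun u u' h => ?_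
    have h1 := congrFun (congrArg Subtype.val h) (Sum.inl (0 : Fin a))
    have h2 := congrFun (congrArg Subtype.val h) (Sum.inr (0 : Fin b))
    refine Subtype.ext (Prod.ext (Subtype.ext ?_) (Subtype.ext ?_))
    · simpa using h1
    · simpa using h2
  · refine le_trans ?_ (ncard_setOf_zpow_eq_one_le (Ω := Ω) hne1)
    refine Set.ncard_le_ncard (s := (f.range : Set Ωˣ)) ?_ (finite_setOf_zpow_eq_one hne1)
    rintro _ ⟨⟨x, y⟩, rfl⟩
    have hx := (zpow_eq_one_iff_mem_rootsOfUnity _ _).mpr x.2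
    have hy := (zpow_eq_one_iff_mem_rootsOfUnity _ _).mpr y.2
    change f (x, y) ^ (Q - 1) = 1
    rw [hf, mul_zpow, ← zpow_mul, ← zpow_mul, geom_sum_mul, geom_sum_mul, hx, hy, one_mul]

/-- The elements of the torus of two cycles of different lengths with repeated entries: those with
a short orbit on one of the two cycles. -/
theorem ncard_not_injective_twoCycles_le (hQ : 2 ≤ Q.natAbs) (hab : a ≠ b) :
    ({t : twistedTorus Ω (twoCycles a b) Q | Function.Injective t.1}ᶜ).ncard ≤
      (shortOrbits Ω Q a).ncard * (∑ i ∈ Finset.range b, Q ^ i).natAbs +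
        (shortOrbits Ω Q b).ncard * (∑ i ∈ Finset.range a, Q ^ i).natAbs := by
  obtain ⟨hA, hA'⟩ := ncard_prod_zpow_eq_one_le (finite_shortOrbits (Ω := Ω) hQ (NeZero.ne a))
    (∑ i ∈ Finset.range a, Q ^ i) (geom_sum_ne_zero_of_two_le_natAbs hQ (NeZero.ne b))
  obtain ⟨hB, hB'⟩ := ncard_prod_zpow_eq_one_le (finite_shortOrbits (Ω := Ω) hQ (NeZero.ne b))
    (∑ i ∈ Finset.range b, Q ^ i) (geom_sum_ne_zero_of_two_le_natAbs hQ (NeZero.ne a))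
  set sa := ∑ i ∈ Finset.range a, Q ^ i
  set sb := ∑ i ∈ Finset.range b, Q ^ i
  -- pairs of an entry on each cycle, the first entry in the pair having a short orbit
  set SA := {u : Ωˣ × Ωˣ | u.1 ∈ shortOrbits Ω Q a ∧ u.1 ^ sa * u.2 ^ sb = 1}
  set SB := {u : Ωˣ × Ωˣ | u.1 ∈ shortOrbits Ω Q b ∧ u.1 ^ sb * u.2 ^ sa = 1}
  refine (Set.ncard_le_ncard_of_injOn (t := SA ∪ Prod.swap '' SB)
    (fun t => (t.1 (Sum.inl 0), t.1 (Sum.inr 0))) ?_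
    apply_zero_injective_twoCycles.injOn (hA.union (hB.image _))).trans
    ((Set.ncard_union_le _ _).trans (add_le_add hA' ((Set.ncard_image_le hB).trans hB')))
  intro t ht
  obtain ⟨hx, hx'⟩ := inl_eq_iterate t.2
  obtain ⟨hy, hy'⟩ := inr_eq_iterate t.2
  have hprod := zpow_geom_sum_mul_eq_one t.2
  by_cases h1 : Function.minimalPeriod (fun y : Ωˣ => y ^ Q) (t.1 (Sum.inl 0)) = a
  · by_cases h2 : Function.minimalPeriod (fun y : Ωˣ => y ^ Q) (t.1 (Sum.inr 0)) = b
    · exact absurd (injective_of_minimalPeriod hab hx hy h1 h2 hx' hy') ht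
    · exact Or.inr ⟨(t.1 (Sum.inr 0), t.1 (Sum.inl 0)), ⟨⟨hy, h2⟩, by rw [mul_comm]; exact hprod⟩,
        rfl⟩
  · exact Or.inl ⟨⟨hx, h1⟩, hprod⟩

theorem ncard_pow_eq_one_twoCycles_le {m : ℕ} (hm : m ≠ 0) :
    {t : twistedTorus Ω (twoCycles a b) Q | t ^ m = 1}.ncard ≤ m ^ 2 := by
  have hm' : (m : ℤ) ≠ 0 := by exact_mod_cast hm
  have hfin := finite_setOf_zpow_eq_one (Ω := Ω) hm'
  refine (Set.ncard_le_ncard_of_injOn (t := {x : Ωˣ | x ^ (m : ℤ) = 1} ×ˢ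
    {x : Ωˣ | x ^ (m : ℤ) = 1}) _ ?_
    apply_zero_injective_twoCycles.injOn (hfin.prod hfin)).trans ?_
  · intro t ht
    have ht : t ^ m = 1 := ht
    have h := congrFun (congrArg Subtype.val ht)
    exact ⟨by simpa using h (Sum.inl 0), by simpa using h (Sum.inr 0)⟩
  · rw [Set.ncard_prod, sq]
    have := ncard_setOf_zpow_eq_one_le (Ω := Ω) hm'
    rw [Int.natAbs_natCast] at this
    exact Nat.mul_le_mul this this

/-- The orbit lengths of the entries of an element of the torus with distinct entries are the
lengths of the cycles. -/
theorem minimalPeriod_inl {d : Fin a ⊕ Fin b → Ωˣ} (hd : d ∈ twistedTorus Ω (twoCycles a b) Q)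
    (hinj : Function.Injective d) (i : Fin a) :
    Function.minimalPeriod (fun y : Ωˣ => y ^ Q) (d (Sum.inl i)) = a := by
  obtain ⟨hx, hx'⟩ := inl_eq_iterate hd
  rw [hx', Function.minimalPeriod_apply_iterate
    (Function.mk_mem_periodicPts (Nat.pos_of_ne_zero (NeZero.ne a)) hx),
    ← injective_iterate_iff hx, ← funext hx']
  exact hinj.comp Sum.inl_injective

theorem minimalPeriod_inr {d : Fin a ⊕ Fin b → Ωˣ} (hd : d ∈ twistedTorus Ω (twoCycles a b) Q)
    (hinj : Function.Injective d) (i : Fin b) :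
    Function.minimalPeriod (fun y : Ωˣ => y ^ Q) (d (Sum.inr i)) = b := by
  obtain ⟨hx, hx'⟩ := inr_eq_iterate hd
  rw [hx', Function.minimalPeriod_apply_iterate
    (Function.mk_mem_periodicPts (Nat.pos_of_ne_zero (NeZero.ne b)) hx),
    ← injective_iterate_iff hx, ← funext hx']
  exact hinj.comp Sum.inr_injective

theorem ncard_range_eq_twoCycles_le (hab : a ≠ b) (r : twistedTorus Ω (twoCycles a b) Q)
    (hr : Function.Injective r.1) :
    {t : twistedTorus Ω (twoCycles a b) Q | Function.Injective t.1 ∧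
      Set.range t.1 = Set.range r.1}.ncard ≤ a * b := by
  refine (Set.ncard_le_ncard_of_injOn
    (t := Set.range (r.1 ∘ Sum.inl) ×ˢ Set.range (r.1 ∘ Sum.inr)) _ ?_
    apply_zero_injective_twoCycles.injOn ((Set.finite_range _).prod (Set.finite_range _))).trans ?_
  · rintro t ⟨ht, htr⟩
    constructor
    · have h : t.1 (Sum.inl 0) ∈ Set.range r.1 := htr ▸ Set.mem_range_self _
      obtain ⟨i | i, hi⟩ := h
      · exact ⟨i, hi⟩
      · exact absurd ((minimalPeriod_inl t.2 ht 0).symm.trans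
          (hi ▸ minimalPeriod_inr r.2 hr i)) hab
    · have h : t.1 (Sum.inr 0) ∈ Set.range r.1 := htr ▸ Set.mem_range_self _
      obtain ⟨i | i, hi⟩ := h
      · exact absurd ((minimalPeriod_inr t.2 ht 0).symm.trans
          (hi ▸ minimalPeriod_inl r.2 hr i)) hab.symm
      · exact ⟨i, hi⟩
  · have hcard : ∀ {c : ℕ} (f : Fin c → Ωˣ), (Set.range f).ncard ≤ c := by
      intro c f
      rw [← Set.image_univ]
      exact (Set.ncard_image_le Set.finite_univ).trans (by simp [Set.ncard_univ])
    rw [Set.ncard_prod]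
    exact Nat.mul_le_mul (hcard _) (hcard _)

/-- The cycle lengths can be read off from the set of entries of an element of the torus with
distinct entries. -/
theorem eq_or_eq_of_range_eq {a' b' : ℕ} [NeZero a'] [NeZero b']
    {d : Fin a ⊕ Fin b → Ωˣ} (hd : d ∈ twistedTorus Ω (twoCycles a b) Q)
    {d' : Fin a' ⊕ Fin b' → Ωˣ} (hd' : d' ∈ twistedTorus Ω (twoCycles a' b') Q)
    (hinj : Function.Injective d) (hinj' : Function.Injective d')
    (h : Set.range d = Set.range d') : a = a' ∨ a = b' := by
  have h1 : d (Sum.inl 0) ∈ Set.range d' := h ▸ Set.mem_range_self _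
  obtain ⟨i | i, hi⟩ := h1
  · exact Or.inl ((minimalPeriod_inl hd hinj 0).symm.trans (hi ▸ minimalPeriod_inl hd' hinj' i))
  · exact Or.inr ((minimalPeriod_inl hd hinj 0).symm.trans (hi ▸ minimalPeriod_inr hd' hinj' i))

end TwoCycles

/-! ### The proportion of powers -/

theorem natAbs_geom_sum_mul (Q : ℤ) (a : ℕ) :
    (∑ i ∈ Finset.range a, Q ^ i).natAbs * (Q - 1).natAbs = (Q ^ a - 1).natAbs := by
  rw [← Int.natAbs_mul, geom_sum_mul]

theorem pow_le_two_mul_natAbs_geom_sum {Q : ℤ} (hQ : 2 ≤ Q.natAbs) (n : ℕ) :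
    Q.natAbs ^ n ≤ 2 * (∑ i ∈ Finset.range (n + 1), Q ^ i).natAbs := by
  set s := (∑ i ∈ Finset.range (n + 1), Q ^ i).natAbs with hs
  have h1 : s * (Q - 1).natAbs = (Q ^ (n + 1) - 1).natAbs := natAbs_geom_sum_mul Q (n + 1)
  have h2 := le_natAbs_pow_sub_one Q (n + 1)
  have h3 : (Q - 1).natAbs ≤ Q.natAbs + 1 := by simpa using natAbs_pow_sub_one_le Q 1
  have h4 : s * (Q - 1).natAbs ≤ s * (Q.natAbs + 1) := Nat.mul_le_mul_left _ h3
  rw [pow_succ] at h2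
  generalize Q.natAbs = q at *
  by_contra! hlt
  have h5 : (2 * s + 1) * (q + 1) ≤ q ^ n * (q + 1) := Nat.mul_le_mul_right _ hlt
  have h6 : q ^ n * 2 ≤ q ^ n * q := Nat.mul_le_mul_left _ hQ
  nlinarith

theorem sum_Icc_pow_add_one_le {q : ℕ} (hq : 2 ≤ q) (h : ℕ) :
    ∑ d ∈ Finset.Icc 1 h, (q ^ d + 1) ≤ 4 * q ^ h := by
  induction h with
  | zero => simp
  | succ h ih =>
    rw [Finset.sum_Icc_succ_top (by omega), pow_succ]
    have h1 : q ^ h * 2 ≤ q ^ h * q := Nat.mul_le_mul_left _ hq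
    have h2 : 1 ≤ q ^ h := Nat.one_le_pow _ _ (by omega)
    omega

/-- Among the `|Q ^ a - 1|` elements fixed by the `a`-fold iterate, a proportion of at most
`8 / q ^ ⌈a / 2⌉` have a short orbit, since its length is at most `a / 2`. -/
theorem ncard_shortOrbits_mul_pow_le {Ω : Type*} [Field Ω] {Q : ℤ} (hQ : 2 ≤ Q.natAbs) {a : ℕ}
    (ha : a ≠ 0) :
    (shortOrbits Ω Q a).ncard * Q.natAbs ^ ((a + 1) / 2) ≤ 8 * (Q ^ a - 1).natAbs := by
  have h1 := (ncard_shortOrbits_le (Ω := Ω) hQ ha).trans (sum_Icc_pow_add_one_le hQ (a / 2))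
  have h2 := le_natAbs_pow_sub_one Q a
  have h3 := Int.natAbs_pos.mpr (pow_sub_one_ne_zero hQ ha)
  calc (shortOrbits Ω Q a).ncard * Q.natAbs ^ ((a + 1) / 2)
      ≤ 4 * Q.natAbs ^ (a / 2) * Q.natAbs ^ ((a + 1) / 2) := Nat.mul_le_mul_right _ h1
    _ = 4 * Q.natAbs ^ a := by
        rw [mul_assoc, ← pow_add]
        congr 2
        omega
    _ ≤ 8 * (Q ^ a - 1).natAbs := by omega

section

variable {G Ω : Type*} [Group G] [Finite G] [Field Ω] [IsAlgClosed Ω] {n : ℕ}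
  {j : G →* Matrix.SpecialLinearGroup (Fin n) Ω} {Q : ℤ}

/-- The `m`-th powers coming from the torus of an `n`-cycle. -/
theorem cycle_le_ncard_range_pow [NeZero n] (hj : Function.Injective j) (hn : 2 ≤ n)
    (hQ : 2 ≤ Q.natAbs) (hQΩ : (Q : Ω) = 0)
    (h : ContainsTwistedTorus j (Equiv.addRight (1 : Fin n)) Q) {m : ℕ} (hm : m ≠ 0) :
    (1 / m - 4 * n / Q.natAbs) / n * (Nat.card G : ℝ) ≤
      ((Set.range fun g : G => g ^ m).ncard : ℝ) := by
  obtain ⟨hfin, τ, hcent, heig⟩ := h.exists_hom hj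
  have key := sum_mul_card_le_ncard_range_pow (J := Unit) Finset.univ
    (fun _ => twistedTorus Ω (Equiv.addRight (1 : Fin n)) Q) (fun _ => τ)
    (fun _ => {t | Function.Injective t.1}) m (fun _ => m) (fun _ => n)
    (fun _ => 4 * n / Q.natAbs) (fun _ _ r hr => hcent r hr) ?_
    (fun _ _ _ _ h => absurd (Subsingleton.elim _ _) h)
    (fun _ _ => ncard_pow_eq_one_cycle_le hm) ?_ (fun _ _ => Nat.pos_of_ne_zero hm)
    (fun _ _ => by omega)
  · simpa using key
  · intro _ _ r hr
    refine le_trans (Set.ncard_le_ncard ?_ (Set.toFinite _)) (ncard_range_eq_cycle_le (Q := Q) r.1)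
    rintro t ⟨-, ht⟩
    ext x
    rw [← heig, ← heig, det_scalar_sub_eq_of_isConj j ht]
  · intro _ _
    have hq : (0 : ℝ) < Q.natAbs := by exact_mod_cast (by omega : 0 < Q.natAbs)
    have h1 : ({t : twistedTorus Ω (Equiv.addRight (1 : Fin n)) Q |
        Function.Injective t.1}ᶜ).ncard ≤ n + n * Q.natAbs ^ (n - 2) := by
      refine (ncard_not_injective_cycle_le hQ).trans (Nat.add_le_add_left ?_ _)
      calc ∑ d ∈ Finset.Icc 2 (n / 2), (Q.natAbs ^ d + 1)
          ≤ ∑ d ∈ Finset.Icc 2 (n / 2), 2 * Q.natAbs ^ (n - 2) := by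
            refine Finset.sum_le_sum fun d hd => ?_
            rw [Finset.mem_Icc] at hd
            have h1 : Q.natAbs ^ d ≤ Q.natAbs ^ (n - 2) :=
              Nat.pow_le_pow_right (by omega) (by omega)
            have h2 : 1 ≤ Q.natAbs ^ (n - 2) := Nat.one_le_pow _ _ (by omega)
            omega
        _ ≤ n * Q.natAbs ^ (n - 2) := by
            rw [Finset.sum_const, Nat.card_Icc, smul_eq_mul, ← mul_assoc]
            exact Nat.mul_le_mul_right _ (by omega)
    have h2 : Q.natAbs ^ (n - 1) ≤
        2 * Nat.card (twistedTorus Ω (Equiv.addRight (1 : Fin n)) Q) := by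
      have h3 := pow_le_two_mul_natAbs_geom_sum hQ (n - 1)
      rw [Nat.sub_add_cancel (by omega)] at h3
      have h4 := card_le_card_twistedTorus_cycle (n := n) hQΩ
      omega
    have h3 : n + n * Q.natAbs ^ (n - 2) ≤ 2 * n * Q.natAbs ^ (n - 2) := by
      have h2 : 1 ≤ Q.natAbs ^ (n - 2) := Nat.one_le_pow _ _ (by omega)
      nlinarith
    rw [div_mul_eq_mul_div, le_div_iff₀ hq]
    have h4 : Q.natAbs ^ (n - 2) * Q.natAbs = Q.natAbs ^ (n - 1) := by
      rw [← pow_succ]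
      congr 1
      omega
    have h5 : ({t : twistedTorus Ω (Equiv.addRight (1 : Fin n)) Q |
        Function.Injective t.1}ᶜ).ncard * Q.natAbs ≤
        4 * n * Nat.card (twistedTorus Ω (Equiv.addRight (1 : Fin n)) Q) := by
      calc _ ≤ 2 * n * Q.natAbs ^ (n - 2) * Q.natAbs := Nat.mul_le_mul_right _ (h1.trans h3)
        _ = 2 * n * Q.natAbs ^ (n - 1) := by rw [mul_assoc, h4]
        _ ≤ 2 * n * (2 * Nat.card (twistedTorus Ω (Equiv.addRight (1 : Fin n)) Q)) :=
          Nat.mul_le_mul_left _ h2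
        _ = _ := by ring
    exact_mod_cast h5

/-- At most a proportion of `O(q ^ (-a / 2))` of the elements of the torus have repeated entries.
The factor `|Q - 1|` lost in the order of the torus cancels against the determinant condition on the
elements with repeated entries. -/
theorem ncard_not_injective_twoCycles_le_mul {a b : ℕ} [NeZero a] [NeZero b] (hab : a < b)
    (hQ : 2 ≤ Q.natAbs) (hQΩ : (Q : Ω) = 0) [Finite (twistedTorus Ω (twoCycles a b) Q)] :
    (({t : twistedTorus Ω (twoCycles a b) Q | Function.Injective t.1}ᶜ).ncard : ℝ) ≤
      16 / (Q.natAbs : ℝ) ^ ((a + 1) / 2) * Nat.card (twistedTorus Ω (twoCycles a b) Q) := by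
  have hq : (0 : ℝ) < (Q.natAbs : ℝ) ^ ((a + 1) / 2) := by
    have : (0 : ℝ) < Q.natAbs := by exact_mod_cast (by omega : 0 < Q.natAbs)
    positivity
  have h0 := ncard_not_injective_twoCycles_le (Ω := Ω) hQ hab.ne
  have hT := mul_le_card_twistedTorus_twoCycles (a := a) (b := b) hQΩ hQ
  have hA := ncard_shortOrbits_mul_pow_le (Ω := Ω) hQ (NeZero.ne a)
  have hB := ncard_shortOrbits_mul_pow_le (Ω := Ω) hQ (NeZero.ne b)
  have hB' : (shortOrbits Ω Q b).ncard * Q.natAbs ^ ((a + 1) / 2) ≤ 8 * (Q ^ b - 1).natAbs :=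
    (Nat.mul_le_mul_left _ (Nat.pow_le_pow_right (by omega) (by omega))).trans hB
  have hsa := natAbs_geom_sum_mul Q a
  have hsb := natAbs_geom_sum_mul Q b
  have hQ1 : 0 < (Q - 1).natAbs := by omega
  rw [div_mul_eq_mul_div, le_div_iff₀ hq]
  have h1 : ({t : twistedTorus Ω (twoCycles a b) Q | Function.Injective t.1}ᶜ).ncard *
      Q.natAbs ^ ((a + 1) / 2) ≤ 16 * Nat.card (twistedTorus Ω (twoCycles a b) Q) := by
    refine Nat.le_of_mul_le_mul_right ?_ hQ1
    generalize (∑ i ∈ Finset.range a, Q ^ i).natAbs = sa at *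
    generalize (∑ i ∈ Finset.range b, Q ^ i).natAbs = sb at *
    generalize (Q ^ a - 1).natAbs = ua at *
    generalize (Q ^ b - 1).natAbs = ub at *
    generalize (Q - 1).natAbs = c at *
    generalize Q.natAbs ^ ((a + 1) / 2) = e at *
    calc _ ≤ ((shortOrbits Ω Q a).ncard * sb + (shortOrbits Ω Q b).ncard * sa) * e * c :=
          Nat.mul_le_mul_right _ (Nat.mul_le_mul_right _ h0)
      _ = ((shortOrbits Ω Q a).ncard * e) * (sb * c) +
          ((shortOrbits Ω Q b).ncard * e) * (sa * c) := by ring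
      _ ≤ 8 * ua * ub + 8 * ub * ua := by
          rw [hsa, hsb]
          exact add_le_add (Nat.mul_le_mul_right _ hA) (Nat.mul_le_mul_right _ hB')
      _ = 16 * (ua * ub) := by ring
      _ ≤ 16 * (Nat.card (twistedTorus Ω (twoCycles a b) Q) * c) := Nat.mul_le_mul_left _ hT
      _ = _ := by ring
  exact_mod_cast h1

/-- The `m`-th powers coming from the tori of two cycles, the shorter one having length
`i + 1 < n / 3`. The condition on the length guarantees that the cycle lengths are determined
by the shorter one. -/
theorem sum_twoCycles_le_ncard_range_pow (hj : Function.Injective j) (hQ : 2 ≤ Q.natAbs)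
    (hQΩ : (Q : Ω) = 0)
    (h : ∀ i < (n - 1) / 3, ContainsTwistedTorus j (twoCycles (i + 1) (n - 2 - i + 1)) Q)
    {m : ℕ} (hm : m ≠ 0) :
    (∑ i ∈ Finset.range ((n - 1) / 3), (1 / (m : ℝ) ^ 2 - 16 / (Q.natAbs : ℝ) ^ ((i + 2) / 2)) /
      ((i + 1) * n)) * (Nat.card G : ℝ) ≤ ((Set.range fun g : G => g ^ m).ncard : ℝ) := by
  -- the index `i` stands for a shorter cycle of length `i + 1` and a longer one of length
  -- `n - 1 - i`, written as a successor so that it is visibly nonzero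
  choose hfin τ hcent heig using fun i : Fin ((n - 1) / 3) => (h i i.isLt).exists_hom hj
  have hlt : ∀ i : Fin ((n - 1) / 3), 3 * (i.1 + 1) < n := fun i => by
    have := i.isLt
    omega
  have key := sum_mul_card_le_ncard_range_pow (J := Fin ((n - 1) / 3)) Finset.univ
    (fun i => twistedTorus Ω (twoCycles (i + 1) (n - 2 - i + 1)) Q) τ
    (fun _ => {t | Function.Injective t.1}) m (fun _ => m ^ 2) (fun i => (i + 1) * n)
    (fun i => 16 / (Q.natAbs : ℝ) ^ ((i + 2) / 2 : ℕ)) (fun i _ r hr => hcent i r hr) ?_ ?_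
    (fun i _ => ncard_pow_eq_one_twoCycles_le hm) ?_
    (fun _ _ => pow_pos (Nat.pos_of_ne_zero hm) 2)
    (fun i _ => Nat.mul_pos (by omega) (by have := hlt i; omega))
  · rw [Finset.sum_range]
    push_cast at key
    exact key
  · intro i _ r hr
    have hi := hlt i
    refine le_trans ?_ (Nat.mul_le_mul_left (i.1 + 1) (by omega : n - 2 - i + 1 ≤ n))
    refine le_trans (Set.ncard_le_ncard ?_ (Set.toFinite _))
      (ncard_range_eq_twoCycles_le (by omega) r hr)
    rintro t ⟨ht, ht'⟩
    refine ⟨ht, ?_⟩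
    ext x
    rw [← heig, ← heig, det_scalar_sub_eq_of_isConj j ht']
  · intro i _ k _ hik r hr r' hr' hconj
    have hi := hlt i
    have hk := hlt k
    have hrange : Set.range r.1 = Set.range r'.1 := by
      ext x
      rw [← heig, ← heig, det_scalar_sub_eq_of_isConj j hconj]
    apply hik
    ext
    have := eq_or_eq_of_range_eq r.2 r'.2 hr hr' hrange
    omega
  · intro i _
    have hi := hlt i
    have := hfin i
    exact ncard_not_injective_twoCycles_le_mul (a := i.1 + 1) (by omega) hQ hQΩ

end

/-- Each power of `1 / q` occurs at most twice in the sum, which is thus bounded by a geometric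
series. -/
theorem sum_range_one_div_pow_le {q : ℝ} (hq : 2 ≤ q) (A : ℕ) :
    ∑ i ∈ Finset.range A, 1 / q ^ ((i + 2) / 2) ≤ 4 / q := by
  have hq0 : 0 < q := by linarith
  have h : ∀ B : ℕ, ∑ i ∈ Finset.range (2 * B), 1 / q ^ ((i + 2) / 2) ≤
      4 / q - 4 / q ^ (B + 1) := by
    intro B
    induction B with
    | zero => simp
    | succ B ih =>
      rw [Nat.mul_succ, Finset.sum_range_succ, Finset.sum_range_succ,
        show (2 * B + 2) / 2 = B + 1 by omega, show (2 * B + 1 + 2) / 2 = B + 1 by omega]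
      have h1 : 4 / q ^ (B + 1 + 1) ≤ 2 / q ^ (B + 1) := by
        rw [pow_succ q (B + 1), div_le_div_iff₀ (by positivity) (by positivity)]
        have : 0 < q ^ (B + 1) := by positivity
        nlinarith
      have h2 : 2 / q ^ (B + 1) = 1 / q ^ (B + 1) + 1 / q ^ (B + 1) := by ring
      have h3 : 4 / q ^ (B + 1) = 2 / q ^ (B + 1) + 2 / q ^ (B + 1) := by ring
      linarith
  calc ∑ i ∈ Finset.range A, 1 / q ^ ((i + 2) / 2)
      ≤ ∑ i ∈ Finset.range (2 * A), 1 / q ^ ((i + 2) / 2) :=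
        Finset.sum_le_sum_of_subset_of_nonneg (Finset.range_mono (by omega))
          fun _ _ _ => by positivity
    _ ≤ 4 / q - 4 / q ^ (A + 1) := h A
    _ ≤ 4 / q := by
        have : 0 < 4 / q ^ (A + 1) := by positivity
        linarith

/-- The harmonic sum over the lengths of the shorter cycle produces the logarithm. -/
theorem log_div_sub_le_sum {n m : ℕ} (hn : 2 ≤ n) {q : ℝ} (hq : 2 ≤ q) :
    (Real.log (n / 3) / (m : ℝ) ^ 2 - 64 / q) / n ≤
      ∑ i ∈ Finset.range ((n - 1) / 3), (1 / (m : ℝ) ^ 2 - 16 / q ^ ((i + 2) / 2)) /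
        ((i + 1) * n) := by
  have hn0 : (0 : ℝ) < n := by exact_mod_cast (by omega : 0 < n)
  have h1 : Real.log (n / 3) ≤ ∑ i ∈ Finset.range ((n - 1) / 3), 1 / ((i : ℝ) + 1) := by
    have h2 := log_add_one_le_harmonic ((n - 1) / 3)
    have h3 : ((harmonic ((n - 1) / 3) : ℚ) : ℝ) =
        ∑ i ∈ Finset.range ((n - 1) / 3), 1 / ((i : ℝ) + 1) := by
      simp [harmonic]
    rw [← h3]
    refine le_trans (Real.log_le_log (by positivity) ?_) h2
    rw [div_le_iff₀ (by norm_num)]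
    exact_mod_cast (by omega : n ≤ ((n - 1) / 3 + 1) * 3)
  have h2 := sum_range_one_div_pow_le hq ((n - 1) / 3)
  rw [div_le_iff₀ hn0, Finset.sum_mul]
  calc Real.log (n / 3) / (m : ℝ) ^ 2 - 64 / q
      ≤ (∑ i ∈ Finset.range ((n - 1) / 3), 1 / ((i : ℝ) + 1)) / (m : ℝ) ^ 2 -
        16 * ∑ i ∈ Finset.range ((n - 1) / 3), 1 / q ^ ((i + 2) / 2) := by
        have h3 : 16 * ∑ i ∈ Finset.range ((n - 1) / 3), 1 / q ^ ((i + 2) / 2) ≤ 64 / q := by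
          calc _ ≤ 16 * (4 / q) := by gcongr
            _ = 64 / q := by ring
        have h4 : Real.log (n / 3) / (m : ℝ) ^ 2 ≤
          (∑ i ∈ Finset.range ((n - 1) / 3), 1 / ((i : ℝ) + 1)) / (m : ℝ) ^ 2 := by gcongr
        linarith
    _ = ∑ i ∈ Finset.range ((n - 1) / 3), (1 / ((i : ℝ) + 1) / (m : ℝ) ^ 2 -
        16 * (1 / q ^ ((i + 2) / 2))) := by
        rw [Finset.sum_sub_distrib, Finset.sum_div, Finset.mul_sum]
    _ ≤ _ := by
        refine Finset.sum_le_sum fun i _ => ?_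
        have hi : (0 : ℝ) < (i : ℝ) + 1 := by positivity
        have hqi : 0 < q ^ ((i + 2) / 2) := by positivity
        have h5 : (1 / (m : ℝ) ^ 2 - 16 / q ^ ((i + 2) / 2)) / ((i + 1) * n) * n =
            1 / ((i : ℝ) + 1) / (m : ℝ) ^ 2 - 16 / q ^ ((i + 2) / 2) / ((i : ℝ) + 1) := by
          field_simp
        rw [h5]
        have h6 : 16 / q ^ ((i + 2) / 2) / ((i : ℝ) + 1) ≤ 16 * (1 / q ^ ((i + 2) / 2)) := by
          rw [mul_one_div]
          exact div_le_self (by positivity) (by linarith [(Nat.cast_nonneg i : (0 : ℝ) ≤ i)])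
        linarith

/-- The numerical estimate for the tori of two cycles. The margin is `log (n / 9) / 2`, which is
positive from `n = 10` on and bounded away from zero for `n ≥ 21`. -/
theorem log_div_le_of_le {n m q : ℕ} (hn : 21 ≤ n) (hm : m ≠ 0) (hq : 2 ≤ q)
    (h : 480 * m ^ 2 ≤ q ∨ 9 * Real.exp (64 * m ^ 2) ≤ n) :
    Real.log n / (2 * n * (m : ℝ) ^ 2) ≤
      (Real.log (n / 3) / (m : ℝ) ^ 2 - 64 / q) / n := by
  have hn' : (21 : ℝ) ≤ n := by exact_mod_cast hn
  have hq' : (2 : ℝ) ≤ q := by exact_mod_cast hq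
  have hm' : (1 : ℝ) ≤ (m : ℝ) ^ 2 := by
    exact_mod_cast Nat.one_le_pow _ _ (Nat.pos_of_ne_zero hm)
  have hlog : Real.log (n / 9) = 2 * Real.log (n / 3) - Real.log n := by
    rw [Real.log_div (by positivity) (by norm_num), Real.log_div (by positivity) (by norm_num),
      show (9 : ℝ) = 3 ^ 2 by norm_num, Real.log_pow]
    push_cast
    ring
  have key : 64 * (m : ℝ) ^ 2 / q ≤ Real.log (n / 9) / 2 := by
    rcases h with h | h
    · have h' : 480 * (m : ℝ) ^ 2 ≤ q := by exact_mod_cast h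
      have h1 : 64 * (m : ℝ) ^ 2 / q ≤ 2 / 7 := by
        rw [div_le_iff₀ (by positivity)]
        linarith
      have h2 := Real.one_sub_inv_le_log_of_pos (by positivity : (0 : ℝ) < n / 9)
      have h3 : ((n : ℝ) / 9)⁻¹ ≤ 3 / 7 := by
        rw [inv_div, div_le_div_iff₀ (by positivity) (by norm_num)]
        linarith
      linarith
    · have h1 : 64 * (m : ℝ) ^ 2 ≤ Real.log (n / 9) := by
        rw [Real.le_log_iff_exp_le (by positivity), le_div_iff₀ (by norm_num)]
        linarith
      have h2 : 64 * (m : ℝ) ^ 2 / q ≤ 64 * (m : ℝ) ^ 2 / 2 := by gcongr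
      linarith
  rw [div_le_div_iff₀ (by positivity) (by positivity)]
  have h1 : Real.log (n / 3) / (m : ℝ) ^ 2 - 64 / q =
      (Real.log (n / 3) - 64 * (m : ℝ) ^ 2 / q) / (m : ℝ) ^ 2 := by
    field_simp
  rw [h1, div_mul_eq_mul_div, le_div_iff₀ (by positivity)]
  have h2 : Real.log n ≤ 2 * (Real.log (n / 3) - 64 * (m : ℝ) ^ 2 / q) := by linarith
  calc Real.log n * n * (m : ℝ) ^ 2 ≤
      2 * (Real.log (n / 3) - 64 * (m : ℝ) ^ 2 / q) * n * (m : ℝ) ^ 2 := by gcongr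
    _ = _ := by ring

/-- The numerical estimate for the torus of an `n`-cycle: as `log n < 7 / 2 < 2 * m`, the term
`1 / m` exceeds `log n / (2 * m ^ 2)`. -/
theorem log_div_le_of_lt {n m q : ℕ} (hn : 2 ≤ n) (hn' : n < 21) (hm : 2 ≤ m)
    (h : 480 * m ^ 2 ≤ q) :
    Real.log n / (2 * n * (m : ℝ) ^ 2) ≤ (1 / m - 4 * n / q) / n := by
  have hm' : (2 : ℝ) ≤ m := by exact_mod_cast hm
  have hn2 : (2 : ℝ) ≤ n := by exact_mod_cast hn
  have h' : 480 * (m : ℝ) ^ 2 ≤ q := by exact_mod_cast h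
  have hq0 : (0 : ℝ) < q := lt_of_lt_of_le (by positivity) h'
  have hlog : Real.log n ≤ 7 / 2 := by
    have h1 : Real.log n ≤ Real.log ((2 : ℝ) ^ 5) := by
      refine Real.log_le_log (by positivity) ?_
      have : (n : ℝ) ≤ 20 := by exact_mod_cast (by omega : n ≤ 20)
      linarith
    rw [Real.log_pow] at h1
    have := Real.log_two_lt_d9
    push_cast at h1
    linarith
  have h1 : 4 * (n : ℝ) / q ≤ 1 / (6 * (m : ℝ) ^ 2) := by
    have : (n : ℝ) ≤ 20 := by exact_mod_cast (by omega : n ≤ 20)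
    rw [div_le_div_iff₀ hq0 (by positivity)]
    nlinarith [sq_nonneg (m : ℝ)]
  rw [show Real.log n / (2 * n * (m : ℝ) ^ 2) = Real.log n / (2 * (m : ℝ) ^ 2) / n by
    field_simp]
  gcongr
  have h2 : Real.log n / (2 * (m : ℝ) ^ 2) + 1 / (6 * (m : ℝ) ^ 2) ≤ 1 / m := by
    rw [show Real.log n / (2 * (m : ℝ) ^ 2) + 1 / (6 * (m : ℝ) ^ 2) =
      (3 * Real.log n + 1) / (6 * (m : ℝ) ^ 2) by field_simp; ring,
      div_le_div_iff₀ (by positivity) (by positivity)]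
    nlinarith
  linarith

/-- The lower bound for any finite group that contains the twisted tori of all permutations with
enough nodes, as soon as one of `q = |Q|` and `n` is large compared with `m`. -/
theorem log_div_mul_card_le_ncard_range_pow {G Ω : Type*} [Group G] [Finite G] [Field Ω]
    [IsAlgClosed Ω] {n : ℕ} {j : G →* Matrix.SpecialLinearGroup (Fin n) Ω} {Q : ℤ}
    (hj : Function.Injective j) (hQ : 2 ≤ Q.natAbs) (hQΩ : (Q : Ω) = 0) (hn : 2 ≤ n)
    (h : ∀ (ι : Type) [Fintype ι] [DecidableEq ι] (π : Equiv.Perm ι) (z : ι → Ω),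
      Fintype.card ι = n → Function.Injective z → (∀ i, z (π i) = z i ^ Q.natAbs) →
        ContainsTwistedTorus j π Q)
    {m : ℕ} (hm : 2 ≤ m)
    (hlarge : 480 * m ^ 2 ≤ Q.natAbs ∨ (21 ≤ n ∧ 9 * Real.exp (64 * m ^ 2) ≤ n)) :
    Real.log n / (2 * n * (m : ℝ) ^ 2) * (Nat.card G : ℝ) ≤
      ((Set.range fun g : G => g ^ m).ncard : ℝ) := by
  have hqΩ : (Q.natAbs : Ω) = 0 := by
    obtain ⟨k, rfl | rfl⟩ := Q.eq_nat_or_neg <;> simpa using hQΩ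
  rcases lt_or_ge n 21 with hn21 | hn21
  · have hq : 480 * m ^ 2 ≤ Q.natAbs := hlarge.resolve_right fun h => by omega
    have : NeZero n := ⟨by omega⟩
    obtain ⟨z, hz, hzπ⟩ := exists_nodes_cycle (n := n) hQ hqΩ
    refine le_trans ?_ (cycle_le_ncard_range_pow hj hn hQ hQΩ
      (h _ _ z (by simp) hz hzπ) (by omega : m ≠ 0))
    exact mul_le_mul_of_nonneg_right (log_div_le_of_lt hn hn21 hm hq) (by positivity)
  · refine le_trans ?_ (sum_twoCycles_le_ncard_range_pow hj hQ hQΩ (fun i hi => ?_)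
      (by omega : m ≠ 0))
    · refine mul_le_mul_of_nonneg_right ?_ (by positivity)
      exact (log_div_le_of_le hn21 (by omega) hQ (hlarge.imp_right And.right)).trans
        (log_div_sub_le_sum hn (by exact_mod_cast hQ))
    · obtain ⟨z, hz, hzπ⟩ := exists_nodes_twoCycles (a := i + 1) (b := n - 2 - i + 1) hQ hqΩ
        (by omega)
      exact h _ _ z (by simp; omega) hz hzπ

/-! ### The groups over finite fields inside the groups over an algebraic closure -/

theorem mem_range_iff_pow_card_eq {K Ω : Type*} [Field K] [Finite K] [Field Ω] (e : K →+* Ω)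
    (x : Ω) : x ∈ e.range ↔ x ^ Nat.card K = x := by
  classical
  have := Fintype.ofFinite K
  have hcard : 1 < Nat.card K := Finite.one_lt_card
  set f : Polynomial Ω := Polynomial.X ^ Nat.card K - Polynomial.X with hf
  have hf0 : f ≠ 0 := FiniteField.X_pow_card_sub_X_ne_zero Ω hcard
  have hroot : ∀ y, y ∈ f.roots.toFinset ↔ y ^ Nat.card K = y := fun y => by
    rw [Multiset.mem_toFinset, Polynomial.mem_roots hf0, Polynomial.IsRoot.def, hf,
      Polynomial.eval_sub, Polynomial.eval_pow, Polynomial.eval_X, sub_eq_zero]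
  have hsub : Finset.univ.image e ⊆ f.roots.toFinset := by
    intro y hy
    obtain ⟨x, -, rfl⟩ := Finset.mem_image.mp hy
    rw [hroot, ← map_pow, Nat.card_eq_fintype_card, FiniteField.pow_card]
  have heq := Finset.eq_of_subset_of_card_le hsub (by
    rw [Finset.card_image_of_injective _ e.injective, Finset.card_univ,
      ← Nat.card_eq_fintype_card]
    refine (Multiset.toFinset_card_le _).trans ((Polynomial.card_roots' f).trans_eq ?_)
    exact FiniteField.X_pow_card_sub_X_natDegree_eq Ω hcard)
  rw [← hroot, ← heq]
  simp

theorem specialLinearGroup_map_injective {K Ω : Type*} [Field K] [Field Ω] {n : ℕ} (e : K →+* Ω) :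
    Function.Injective (Matrix.SpecialLinearGroup.map (n := Fin n) e) := by
  intro A B h
  ext i k
  apply e.injective
  exact congrFun (congrFun (congrArg Subtype.val h) i) k

theorem exists_map_eq_of_forall_mem_range {K Ω : Type*} [Field K] [Field Ω] {n : ℕ} (e : K →+* Ω)
    (A : Matrix.SpecialLinearGroup (Fin n) Ω) (hA : ∀ i k, A.1 i k ∈ e.range) :
    ∃ B : Matrix.SpecialLinearGroup (Fin n) K, Matrix.SpecialLinearGroup.map e B = A := by
  choose B hB using hA
  have hBe : (Matrix.of B).map e = A.1 := by
    ext i k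
    exact hB i k
  have hdet : (Matrix.of B).det = 1 := by
    apply e.injective
    rw [RingHom.map_det, RingHom.mapMatrix_apply, hBe, A.2, map_one]
  exact ⟨⟨_, hdet⟩, Subtype.ext hBe⟩

theorem mem_range_map_iff {K Ω : Type*} [Field K] [Field Ω] {n : ℕ} (e : K →+* Ω) (φ : Ω →+* Ω)
    (he : ∀ x, φ x = x ↔ x ∈ e.range) (A : Matrix.SpecialLinearGroup (Fin n) Ω) :
    A ∈ (Matrix.SpecialLinearGroup.map (n := Fin n) e).range ↔ A.1.map φ = A.1 := by
  constructor
  · rintro ⟨B, rfl⟩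
    ext i k
    exact (he _).mpr ⟨B.1 i k, rfl⟩
  · intro h
    exact exists_map_eq_of_forall_mem_range e A fun i k => (he _).mp (congrFun (congrFun h i) k)

theorem mem_range_map_comp_subtype_iff {K Ω : Type*} [Field K] [Field Ω] {n : ℕ} (e : K →+* Ω)
    (φ : Ω →+* Ω) (σ : K →+* K) (heσ : ∀ x, e (σ x) = φ (e x))
    (he : ∀ x, φ (φ x) = x ↔ x ∈ e.range) (A : Matrix.SpecialLinearGroup (Fin n) Ω) :
    A ∈ ((Matrix.SpecialLinearGroup.map (n := Fin n) e).comp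
        (specialUnitarySubgroup n σ).subtype).range ↔ A.1 * (A.1.map φ).transpose = 1 := by
  have hmap : ∀ B : Matrix (Fin n) (Fin n) K, (B * (B.map σ).transpose).map e =
      B.map e * ((B.map e).map φ).transpose := by
    intro B
    rw [Matrix.map_mul]
    congr 1
    ext i k
    simp [heσ]
  constructor
  · rintro ⟨⟨B, hB⟩, rfl⟩
    have hB : B.1 * (B.1.map σ).transpose = 1 := hB
    change B.1.map e * ((B.1.map e).map φ).transpose = 1
    rw [← hmap, hB, Matrix.map_one _ (map_zero e) (map_one e)]
  · intro h
    have h1 : (A.1.map φ).map φ * (A.1.map φ).transpose = 1 := by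
      have h2 : ((A.1 * (A.1.map φ).transpose).map φ).transpose =
          ((1 : Matrix (Fin n) (Fin n) Ω).map φ).transpose := by rw [h]
      rw [Matrix.map_mul, Matrix.transpose_mul, Matrix.map_one _ (map_zero φ) (map_one φ),
        Matrix.transpose_one] at h2
      rw [← h2]
      rfl
    have h2 : (A.1.map φ).map φ = A.1 := by
      calc (A.1.map φ).map φ = (A.1.map φ).map φ * ((A.1.map φ).transpose * A.1) := by
            rw [mul_eq_one_comm.mp h, Matrix.mul_one]
        _ = A.1 := by rw [← Matrix.mul_assoc, h1, Matrix.one_mul]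
    obtain ⟨B, hB⟩ := exists_map_eq_of_forall_mem_range e A fun i k =>
      (he _).mp (congrFun (congrFun h2 i) k)
    have hBA : B.1.map e = A.1 := congrArg Subtype.val hB
    refine ⟨⟨B, ?_⟩, hB⟩
    change B.1 * (B.1.map σ).transpose = 1
    have h3 : (B.1 * (B.1.map σ).transpose).map e = (1 : Matrix (Fin n) (Fin n) K).map e := by
      rw [hmap, hBA, h, Matrix.map_one _ (map_zero e) (map_one e)]
    exact Matrix.map_injective e.injective h3

/-- Every element of `K` fixed by the involution `σ` is a norm `x * σ x`: solve the equation in an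
algebraically closed field; the solution is fixed by the square of the Frobenius map. -/
theorem exists_mul_apply_eq {K Ω : Type*} [Field K] [Field Ω] [IsAlgClosed Ω] {q : ℕ}
    (φ : Ω →+* Ω) (hφ : ∀ x, φ x = x ^ q) (σ : K →+* K) (e : K →+* Ω)
    (heσ : ∀ x, e (σ x) = φ (e x)) (he : ∀ x, φ (φ x) = x ↔ x ∈ e.range) (c : K) (hc : σ c = c) :
    ∃ x, x * σ x = c := by
  rcases eq_or_ne c 0 with rfl | hc0
  · exact ⟨0, zero_mul _⟩
  obtain ⟨y, hy⟩ := IsAlgClosed.exists_pow_nat_eq (e c) (Nat.succ_pos q)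
  have hy1 : y * φ y = e c := by rw [hφ, ← hy, pow_succ']
  have hy0 : φ y ≠ 0 := by
    intro h
    rw [h, mul_zero, eq_comm, map_eq_zero] at hy1
    exact hc0 hy1
  have hy2 : φ (φ y) = y := by
    have h := congrArg φ hy1
    rw [map_mul, ← heσ, hc, ← hy1, mul_comm y] at h
    exact mul_left_cancel₀ hy0 h
  obtain ⟨x, rfl⟩ := (he y).mp hy2
  exact ⟨x, e.injective (by rw [map_mul, heσ, hy1])⟩

theorem exists_add_pow_ne_zero {K : Type*} [Field K] [Finite K] {q : ℕ} (hq : 2 ≤ q)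
    (hK : q < Nat.card K) : ∃ x : K, x + x ^ q ≠ 0 := by
  by_contra! h
  have := Fintype.ofFinite K
  have hdeg : (Polynomial.X ^ q + Polynomial.X : Polynomial K).natDegree = q := by
    rw [Polynomial.natDegree_add_eq_left_of_natDegree_lt, Polynomial.natDegree_X_pow]
    rw [Polynomial.natDegree_X_pow, Polynomial.natDegree_X]
    omega
  have h0 := Polynomial.eq_zero_of_natDegree_lt_card_of_eval_eq_zero
    (Polynomial.X ^ q + Polynomial.X : Polynomial K) Function.injective_id
    (fun x => by simpa [add_comm] using h x) (by rwa [hdeg, ← Nat.card_eq_fintype_card])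
  rw [h0, Polynomial.natDegree_zero] at hdeg
  omega

theorem card_specialLinearGroup_le {K : Type*} [Field K] [Finite K] (n : ℕ) :
    Nat.card (Matrix.SpecialLinearGroup (Fin n) K) ≤ Nat.card K ^ n ^ 2 := by
  have : Finite (Matrix (Fin n) (Fin n) K) := inferInstanceAs (Finite (Fin n → Fin n → K))
  refine (Nat.card_le_card_of_injective _ Subtype.val_injective).trans_eq ?_
  have h : Nat.card (Matrix (Fin n) (Fin n) K) = Nat.card (Fin n → Fin n → K) := rfl
  rw [h, Nat.card_fun, Nat.card_fun, Nat.card_fin, ← pow_mul, sq]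

section FiniteField

variable {n p k m : ℕ} [Fact p.Prime]

theorem two_le_prime_pow (hk : 1 ≤ k) : 2 ≤ p ^ k :=
  (Fact.out : p.Prime).two_le.trans (Nat.le_self_pow (by omega) p)

theorem specialLinearGroup_log_le_ncard_range_pow (hn : 2 ≤ n) (hk : 1 ≤ k) (hm : 2 ≤ m)
    (hlarge : 480 * m ^ 2 ≤ p ^ k ∨ (21 ≤ n ∧ 9 * Real.exp (64 * m ^ 2) ≤ n)) :
    Real.log n / (2 * n * (m : ℝ) ^ 2) *
        (Nat.card (Matrix.SpecialLinearGroup (Fin n) (GaloisField p k)) : ℝ) ≤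
      ((Set.range fun g : Matrix.SpecialLinearGroup (Fin n) (GaloisField p k) =>
        g ^ m).ncard : ℝ) := by
  let Ω := AlgebraicClosure (ZMod p)
  have : CharP Ω p := charP_of_injective_algebraMap (algebraMap (ZMod p) Ω).injective p
  let e : GaloisField p k →+* Ω := (IsAlgClosed.lift : GaloisField p k →ₐ[ZMod p] Ω).toRingHom
  let φ : Ω →+* Ω := iterateFrobenius Ω p k
  have hφ : ∀ x, φ x = x ^ p ^ k := iterateFrobenius_def p k
  have he : ∀ x, φ x = x ↔ x ∈ e.range := fun x => by
    rw [mem_range_iff_pow_card_eq, GaloisField.card p k (by omega), hφ]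
  have : Finite (Matrix.SpecialLinearGroup (Fin n) (GaloisField p k)) :=
    Finite.of_injective _ Subtype.val_injective
  refine log_div_mul_card_le_ncard_range_pow (Q := (p ^ k : ℕ))
    (specialLinearGroup_map_injective (n := n) e)
    (by simpa using two_le_prime_pow hk) ?_ hn ?_ hm (by simpa using hlarge)
  · push_cast
    rw [CharP.cast_eq_zero, zero_pow (by omega)]
  · intro ι _ _ π z hι hz hzπ
    exact containsTwistedTorus_of_range_eq_map_eq φ hφ (mem_range_map_iff e φ he) hι hz
      (by simpa using hzπ)

theorem specialUnitaryGroup_log_le_ncard_range_pow (hn : 2 ≤ n) (hk : 1 ≤ k) (hm : 2 ≤ m)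
    (hlarge : 480 * m ^ 2 ≤ p ^ k ∨ (21 ≤ n ∧ 9 * Real.exp (64 * m ^ 2) ≤ n)) :
    Real.log n / (2 * n * (m : ℝ) ^ 2) * (Nat.card (SUGroup n p k) : ℝ) ≤
      ((Set.range fun g : SUGroup n p k => g ^ m).ncard : ℝ) := by
  let Ω := AlgebraicClosure (ZMod p)
  have : CharP Ω p := charP_of_injective_algebraMap (algebraMap (ZMod p) Ω).injective p
  let K := GaloisField p (2 * k)
  let e : K →+* Ω := (IsAlgClosed.lift : K →ₐ[ZMod p] Ω).toRingHom
  let φ : Ω →+* Ω := iterateFrobenius Ω p k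
  let σ : K →+* K := iterateFrobenius K p k
  have hq := two_le_prime_pow (p := p) hk
  have hφ : ∀ x, φ x = x ^ p ^ k := iterateFrobenius_def p k
  have hσ : ∀ x, σ x = x ^ p ^ k := iterateFrobenius_def p k
  have hK : Nat.card K = p ^ k * p ^ k := by
    rw [GaloisField.card p (2 * k) (by omega), two_mul, pow_add]
  have he : ∀ x, φ (φ x) = x ↔ x ∈ e.range := fun x => by
    rw [mem_range_iff_pow_card_eq, hK, hφ, hφ, pow_mul]
  have heσ : ∀ x, e (σ x) = φ (e x) := fun x => by rw [hφ, hσ, map_pow]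
  have hne : ∃ x, x + σ x ≠ 0 := by
    simp only [hσ]
    exact exists_add_pow_ne_zero hq (by rw [hK]; nlinarith)
  have : Finite (Matrix.SpecialLinearGroup (Fin n) K) := Finite.of_injective _ Subtype.val_injective
  have hinj : Function.Injective ((Matrix.SpecialLinearGroup.map (n := Fin n) e).comp
      (SUGroup n p k).subtype) :=
    (specialLinearGroup_map_injective e).comp Subtype.val_injective
  refine log_div_mul_card_le_ncard_range_pow (Q := -(p ^ k : ℕ)) hinj
    (by simpa using hq) ?_ hn ?_ hm (by simpa using hlarge)
  · push_cast
    rw [CharP.cast_eq_zero, zero_pow (by omega), neg_zero]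
  · intro ι _ _ π z hι hz hzπ
    exact containsTwistedTorus_of_range_eq_unitary φ hφ σ e heσ he hne
      (exists_mul_apply_eq φ hφ σ e heσ he) (mem_range_map_comp_subtype_iff e φ σ heσ he) hι hz
      (by simpa using hzπ)

end FiniteField

/-- A group of large order has a large field of definition or a large rank. -/
theorem le_or_le_of_pow_lt_card {n n₀ q q₀ c : ℕ} (hq : 2 ≤ q) (hc : c ≤ q ^ (2 * n ^ 2))
    (h : q₀ ^ (2 * n₀ ^ 2) + 1 ≤ c) : q₀ ≤ q ∨ n₀ ≤ n := by
  by_contra! hlt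
  have h1 : q ^ (2 * n ^ 2) ≤ q₀ ^ (2 * n₀ ^ 2) :=
    (Nat.pow_le_pow_left hlt.1.le _).trans
      (Nat.pow_le_pow_right (by omega) (Nat.mul_le_mul_left 2 (Nat.pow_le_pow_left hlt.2.le 2)))
  omega

theorem log_div_mul_card_le_ncard_wordImage_quotient {G : Type*} [Group G] [Finite G]
    (N : Subgroup G) [N.Normal] (M : ℤ) (n : ℕ)
    (h : Real.log n / (2 * n * (M.natAbs : ℝ) ^ 2) * (Nat.card G : ℝ) ≤
      ((Set.range fun g : G => g ^ M.natAbs).ncard : ℝ)) :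
    Real.log n / (2 * n * (M : ℝ) ^ 2) * (Nat.card (G ⧸ N) : ℝ) ≤
      ((wordImage (powerWord M) (G ⧸ N)).ncard : ℝ) := by
  have hM : (M : ℝ) ^ 2 = (M.natAbs : ℝ) ^ 2 := by
    rw [Nat.cast_natAbs, Int.cast_abs, sq_abs]
  rw [wordImage_powerWord, range_zpow_eq_range_pow_natAbs, hM]
  exact mul_card_quotient_le_ncard_range_pow N M.natAbs _ h

theorem log_div_mul_card_le_ncard_range_pow_one {G : Type*} [Group G] [Finite G] (n : ℕ) :
    Real.log n / (2 * n * ((1 : ℕ) : ℝ) ^ 2) * (Nat.card G : ℝ) ≤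
      ((Set.range fun g : G => g ^ 1).ncard : ℝ) := by
  have h1 : (Set.range fun g : G => g ^ 1).ncard = Nat.card G := by
    simp [Set.ncard_univ]
  rw [h1]
  refine mul_le_of_le_one_left (by positivity) (div_le_one_of_le₀ ?_ (by positivity))
  have h2 := Real.log_le_self (Nat.cast_nonneg n)
  have h3 : (0 : ℝ) ≤ n := Nat.cast_nonneg n
  push_cast
  linarith

theorem theorem1p2 (M : ℤ) (hM : M ≠ 0) :
    ∃ N : ℕ, 0 < N ∧ ∀ (n p k : ℕ) [Fact p.Prime], 2 ≤ n → 1 ≤ k →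
      (N ≤ Nat.card (PSLGroup n p k) →
        Real.log n / (2 * n * (M : ℝ) ^ 2) * (Nat.card (PSLGroup n p k) : ℝ) ≤
          ((wordImage (powerWord M) (PSLGroup n p k)).ncard : ℝ)) ∧
      (N ≤ Nat.card (PSUGroup n p k) →
        Real.log n / (2 * n * (M : ℝ) ^ 2) * (Nat.card (PSUGroup n p k) : ℝ) ≤
          ((wordImage (powerWord M) (PSUGroup n p k)).ncard : ℝ)) := by
  have hm0 : M.natAbs ≠ 0 := Int.natAbs_ne_zero.mpr hM
  set q₀ := 480 * M.natAbs ^ 2 with hq₀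
  set n₀ := 21 + ⌈9 * Real.exp (64 * (M.natAbs : ℝ) ^ 2)⌉₊ with hn₀
  -- both groups have order at most `q ^ (2 * n ^ 2)`
  refine ⟨q₀ ^ (2 * n₀ ^ 2) + 1, Nat.succ_pos _, ?_⟩
  intro n p k _ hn hk
  have hq := two_le_prime_pow (p := p) hk
  have hSL : Finite (Matrix.SpecialLinearGroup (Fin n) (GaloisField p k)) :=
    Finite.of_injective _ Subtype.val_injective
  have hSL' : Finite (Matrix.SpecialLinearGroup (Fin n) (GaloisField p (2 * k))) :=
    Finite.of_injective _ Subtype.val_injective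
  have hlarge : ∀ c, c ≤ (p ^ k) ^ (2 * n ^ 2) → q₀ ^ (2 * n₀ ^ 2) + 1 ≤ c →
      q₀ ≤ p ^ k ∨ (21 ≤ n ∧ 9 * Real.exp (64 * (M.natAbs : ℝ) ^ 2) ≤ n) := by
    intro c hc h
    refine (le_or_le_of_pow_lt_card hq hc h).imp_right fun h => ⟨by omega, ?_⟩
    refine (Nat.le_ceil _).trans ?_
    exact_mod_cast (by omega : ⌈9 * Real.exp (64 * (M.natAbs : ℝ) ^ 2)⌉₊ ≤ n)
  rcases (by omega : M.natAbs = 1 ∨ 2 ≤ M.natAbs) with hm | hm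
  · refine ⟨fun _ => ?_, fun _ => ?_⟩ <;>
    · apply log_div_mul_card_le_ncard_wordImage_quotient
      rw [hm]
      exact log_div_mul_card_le_ncard_range_pow_one n
  · refine ⟨fun h => ?_, fun h => ?_⟩
    · apply log_div_mul_card_le_ncard_wordImage_quotient
      refine specialLinearGroup_log_le_ncard_range_pow hn hk hm (hlarge _ ?_ h)
      refine (Nat.card_le_card_of_surjective _ (QuotientGroup.mk'_surjective _)).trans
        ((card_specialLinearGroup_le n).trans ?_)
      rw [GaloisField.card p k (by omega)]
      exact Nat.pow_le_pow_right (by omega) (by omega)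
    · apply log_div_mul_card_le_ncard_wordImage_quotient
      refine specialUnitaryGroup_log_le_ncard_range_pow hn hk hm (hlarge _ ?_ h)
      refine (Nat.card_le_card_of_surjective _ (QuotientGroup.mk'_surjective _)).trans
        ((Nat.card_le_card_of_injective _ Subtype.val_injective).trans
          ((card_specialLinearGroup_le n).trans_eq ?_))
      rw [GaloisField.card p (2 * k) (by omega), ← pow_mul, ← pow_mul]
      congr 1
      ring
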